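/- Let $\ell_1,\dots,\ell_t$ be nonzero linear forms on $\mathbb R^d$, and let $L$ be the lattice of all intersections of subfamilies of the hyperplanes $\ker\ell_k\subseteq\mathbb R^d$ (including the empty intersection $\widehat 1=\mathbb R^d$), ordered by inclusion, with Möbius function $\mu_L$. Regard the $\ell_k$ also as complex linear forms on $\mathbb C^d$ with real coefficients, and let $L_{\mathrm{aug}}$ be the poset, ordered by inclusion, of all intersections of subfamilies of the $2t$ real subspaces $\{z:\ell_k(z)=0\}$ and $\{z:\operatorname{Im}\ell_k(z)=0\}$ of $\mathbb C^d$. Let $\mathrm{Int}(L)$ be the set of intervals $[\alpha,\beta]$ ($\alpha\le\beta$ in $L$), ordered componentwise; it is identified with $L_{\mathrm{aug}}$ through the isomorphism $[\alpha,\beta]\mapsto\{x+iy: x\in\beta,\ y\in\alpha\}$. The position vector $\sigma(z)\in\{0,+,-,i,j\}^t$ of $z\in\mathbb C^d$ has $k$-th entry $0$ if $\ell_k(z)=0$; $+$ or $-$ if $\ell_k(z)$ is real and positive or negative; $i$ or $j$ if $\operatorname{Im}\ell_k(z)$ is positive or negative. Order the signs by $0<+,-$ and $+,-<i,j$, and let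 $F=\sigma(\mathbb C^d)$ be the monoid with the composition $(Z\circ W)_k=W_k$ if $W_k>Z_k$ and $(Z\circ W)_k=Z_k$ otherwise. For $Z\in F$ let $\mathrm{supp}(Z)\in L_{\mathrm{aug}}$ be the intersection of all the above $2t$ subspaces that contain $\sigma^{-1}(Z)$. Fix $\pi\in L$, let $\Sigma=\mathrm{Fib}([\pi,\widehat 1])=\{Z\in F:\mathrm{supp}(Z)\le[\pi,\widehat 1]\}$ be the fiber semigroup, let $\max(\Sigma)$ be the set of its maximal elements for the order $x\le y\Leftrightarrow x\circ y=y$, let $w$ be a probability distribution on $\Sigma$, and let $P_w(c,e)=\sum_{x\in\Sigma:\,x\circ c=e}w_x$ for $c,e\in\max(\Sigma)$. For $[\alpha,\beta]\in\mathrm{Int}(L)$ put $\varepsilon_{(\alpha,\beta)}=\sum_{y\in\Sigma:\,\mathrm{supp}(y)\le[\alpha,\beta]}w_y$. Then: 1. The matrix $P_w$ is diagonalizable (over $\mathbb R$). 2. For all $\alpha,\beta\in L$ with $\alpha\le\pi\le\beta$, the number $\varepsilon_{(\alpha,\beta)}$ is an eigenvalue of $P_w$. 3. The multiplicity of $\varepsilon_{(\alpha,\beta)}$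 is $|\mu_L(\alpha,\pi)\,\mu_L(\beta,\widehat 1)|$, where the multiplicities of pairs with the same value are added; that is, the characteristic polynomial of $P_w$ is $\prod_{\alpha\le\pi\le\beta}(T-\varepsilon_{(\alpha,\beta)})^{|\mu_L(\alpha,\pi)\,\mu_L(\beta,\widehat 1)|}$. 4. These are all the eigenvalues of $P_w$. 5. If $\Sigma$ is generated, as a monoid, by $\{x\in\Sigma: w_x>0\}$, then the random walk on $\max(\Sigma)$ has a unique stationary distribution. -/

import Mathlib

namespace HypArr

/-! ### Walks on finite monoids -/

section Walks

variable (M : Type*) [Monoid M]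

/-- The maximal elements of a left regular band `M` for the order `x ≤ y ↔ x * y = y`. -/
def maxElements : Set M := {c | ∀ x : M, c * x = x → x = c}

variable {M}

open Classical in
/-- The transition matrix of the walk on the maximal elements of `M` driven by the weights `w`:
from `c` move to `x * c` with probability `w x`. -/
noncomputable def transitionMatrix [Fintype M] (w : M → ℝ) :
    Matrix (maxElements M) (maxElements M) ℝ :=
  Matrix.of fun c d => ∑ x : M with x * (c : M) = (d : M), w x

end Walks

/-- A real square matrix is diagonalizable: it is similar over `ℝ` to a diagonal matrix. -/
def IsDiagonalizable {n : Type*} [Fintype n] [DecidableEq n] (P : Matrix n n ℝ) : Prop :=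
  ∃ (Q : Matrix n n ℝ) (D : n → ℝ), IsUnit Q ∧ P * Q = Q * Matrix.diagonal D

/-! ### Posets -/

open Classical in
/-- The Möbius function of a finite poset. -/
noncomputable def moebius {α : Type*} [PartialOrder α] [Fintype α] (x y : α) : ℤ :=
  letI : LocallyFiniteOrder α := Fintype.toLocallyFiniteOrder
  IncidenceAlgebra.mu ℤ x y

/-- The poset of closed intervals `[x, y]` of a poset, ordered componentwise:
`[x, y] ≤ [x', y']` iff `x ≤ x'` and `y ≤ y'`. -/
abbrev Intervals (α : Type*) [PartialOrder α] : Type _ := {p : α × α // p.1 ≤ p.2}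

/-! ### Complex signs -/

/-- The signs `0, +, -, i, j`. -/
inductive CSign
  | zero | pos | neg | i | j
  deriving DecidableEq

namespace CSign

instance : Fintype CSign where
  elems := {zero, pos, neg, i, j}
  complete a := by cases a <;> decide

/-- The height of a sign: `0` is below `+, -`, which are below `i, j`. -/
def height : CSign → ℕ
  | zero => 0
  | pos => 1
  | neg => 1
  | i => 2
  | j => 2

/-- The order on signs, with relations `0 < + , -` and `+ , - < i , j`. -/
instance : PartialOrder CSign where
  le a b := a = b ∨ a.height < b.height
  lt a b := a.height < b.height
  le_refl a := Or.inl rfl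
  le_trans a b c := by rintro (rfl | h) (rfl | h') <;> first | tauto | (right; omega)
  le_antisymm a b := by rintro (rfl | h) (h' | h') <;> first | rfl | exact h'.symm | omega
  lt_iff_le_not_ge a b := by
    constructor
    · intro h
      refine ⟨Or.inr h, ?_⟩
      rintro (rfl | h') <;> omega
    · rintro ⟨rfl | h, h'⟩
      · exact absurd (Or.inl rfl) h'
      · exact h

instance : DecidableLT CSign := fun a b => inferInstanceAs (Decidable (a.height < b.height))

/-- Composition of signs: `a * b` is `b` if `b > a`, and is `a` otherwise. -/
instance : Monoid CSign where
  mul a b := if a < b then b else a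
  one := zero
  mul_assoc := by decide
  one_mul := by decide
  mul_one := by decide

/-- The sign of a complex number. -/
noncomputable def ofComplex (z : ℂ) : CSign :=
  if z.im = 0 then
    if z.re = 0 then zero else if 0 < z.re then pos else neg
  else if 0 < z.im then i else j

theorem ofComplex_eq_one_iff (z : ℂ) : ofComplex z = 1 ↔ z = 0 := by
  change ofComplex z = zero ↔ z = 0
  rw [Complex.ext_iff]
  unfold ofComplex
  split_ifs <;> simp_all

theorem height_ofComplex_le_iff (z : ℂ) : (ofComplex z).height ≤ 1 ↔ z.im = 0 := by
  unfold ofComplex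
  split_ifs <;> simp_all [height]

theorem height_mul_le : ∀ a b : CSign, a.height ≤ 1 → b.height ≤ 1 → (a * b).height ≤ 1 := by
  decide

open Filter Topology in
/-- Moving a little from `a` in the direction `b` composes the signs. -/
theorem eventually_ofComplex (a b : ℂ) :
    ∀ᶠ ε : ℝ in 𝓝[>] 0, ofComplex (a + ε * b) = ofComplex a * ofComplex b := by
  have hpos : ∀ x y : ℝ, 0 < x → ∀ᶠ ε : ℝ in 𝓝[>] 0, 0 < x + ε * y := fun x y hx => by
    have h : Tendsto (fun ε : ℝ => x + ε * y) (𝓝[>] 0) (𝓝 x) := by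
      have : Continuous fun ε : ℝ => x + ε * y := by fun_prop
      simpa using (this.tendsto 0).mono_left nhdsWithin_le_nhds
    exact h.eventually (lt_mem_nhds hx)
  have hneg : ∀ x y : ℝ, x < 0 → ∀ᶠ ε : ℝ in 𝓝[>] 0, x + ε * y < 0 := fun x y hx => by
    filter_upwards [hpos (-x) (-y) (by linarith)] with ε h
    linarith
  have him : ∀ ε : ℝ, (a + ε * b).im = a.im + ε * b.im := by simp
  have hre : ∀ ε : ℝ, (a + ε * b).re = a.re + ε * b.re := by simp
  have hi : ∀ s, i * s = i := by decide
  have hj : ∀ s, j * s = j := by decide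
  have hi' : ∀ s, s.height ≤ 1 → s * i = i := by decide
  have hj' : ∀ s, s.height ≤ 1 → s * j = j := by decide
  have hp : ∀ s, s.height ≤ 1 → pos * s = pos := by decide
  have hn : ∀ s, s.height ≤ 1 → neg * s = neg := by decide
  have ei : ∀ z : ℂ, 0 < z.im → ofComplex z = i := fun z h => by simp [ofComplex, h, h.ne']
  have ej : ∀ z : ℂ, z.im < 0 → ofComplex z = j := fun z h => by
    simp [ofComplex, h.ne, h.not_gt]
  have ep : ∀ z : ℂ, z.im = 0 → 0 < z.re → ofComplex z = pos := fun z h h' => by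
    simp [ofComplex, h, h', h'.ne']
  have en : ∀ z : ℂ, z.im = 0 → z.re < 0 → ofComplex z = neg := fun z h h' => by
    simp [ofComplex, h, h'.ne, h'.not_gt]
  rcases lt_trichotomy a.im 0 with h | h | h
  · filter_upwards [hneg _ b.im h] with ε h'
    rw [ej _ (by rwa [him]), ej _ h, hj]
  · have ha := (height_ofComplex_le_iff a).2 h
    rcases lt_trichotomy b.im 0 with k | k | k
    · filter_upwards [self_mem_nhdsWithin] with ε (h' : 0 < ε)
      rw [ej (a + ε * b) (by rw [him, h]; nlinarith), ej b k, hj' _ ha]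
    · have hb := (height_ofComplex_le_iff b).2 k
      rcases lt_trichotomy a.re 0 with m | m | m
      · filter_upwards [hneg _ b.re m] with ε h'
        rw [en _ (by simp [h, k]) (by rwa [hre]), en a h m, hn _ hb]
      · have h0 : a = 0 := Complex.ext m h
        filter_upwards [self_mem_nhdsWithin] with ε (h' : 0 < ε)
        rw [(ofComplex_eq_one_iff a).2 h0, one_mul, h0, zero_add]
        simp [ofComplex, h'.ne', h']
      · filter_upwards [hpos _ b.re m] with ε h'
        rw [ep _ (by simp [h, k]) (by rwa [hre]), ep a h m, hp _ hb]
    · filter_upwards [self_mem_nhdsWithin] with ε (h' : 0 < ε)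
      rw [ei (a + ε * b) (by rw [him, h]; nlinarith), ei b k, hi' _ ha]
  · filter_upwards [hpos _ b.im h] with ε h'
    rw [ei _ (by rwa [him]), ei _ h, hi]

end CSign

/-! ### Intersection lattices -/

section Intersections

variable {R V κ : Type*} [Ring R] [AddCommGroup V] [Module R V]

/-- All intersections of subfamilies of a family of subspaces (the empty intersection is the whole
space), ordered by inclusion. -/
def intersections (H : κ → Submodule R V) : Set (Submodule R V) :=
  Set.range fun s : Set κ => ⨅ k ∈ s, H k

theorem finite_intersections [Finite κ] (H : κ → Submodule R V) : Finite (intersections H) :=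
  Set.finite_range _

noncomputable instance [Finite κ] (H : κ → Submodule R V) : Fintype (intersections H) :=
  letI := finite_intersections H
  Fintype.ofFinite _

/-- The largest element of the lattice is the whole space. -/
instance (H : κ → Submodule R V) : OrderTop (intersections H) where
  top := ⟨⊤, ∅, by simp⟩
  le_top _ := Subtype.coe_le_coe.1 le_top

end Intersections

/-! ### Complex arrangements -/

section Complex

variable {d t : ℕ} (l : Fin t → Module.Dual ℂ (Fin d → ℂ))

/-- The position vector of a point with respect to the linear forms `l`. -/
noncomputable def position (z : Fin d → ℂ) : Fin t → CSign :=
  fun k => CSign.ofComplex (l k z)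

/-- The imaginary part of a form, as a real linear functional. -/
noncomputable def imForm (f : Module.Dual ℂ (Fin d → ℂ)) : (Fin d → ℂ) →ₗ[ℝ] ℝ :=
  Complex.imLm ∘ₗ f.restrictScalars ℝ

/-- The augmented arrangement: the complex hyperplanes `l k z = 0`, viewed as real subspaces, and
the real hyperplanes `Im (l k z) = 0`. -/
noncomputable def augmented : Fin t ⊕ Fin t → Submodule ℝ (Fin d → ℂ) :=
  Sum.elim (fun k => (LinearMap.ker (l k)).restrictScalars ℝ)
    (fun k => LinearMap.ker (imForm (l k)))

/-- The augmented intersection lattice. -/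
abbrev AugLattice : Type := intersections (augmented l)

/-- The face semigroup: all position vectors, under componentwise composition. -/
noncomputable def faces : Submonoid (Fin t → CSign) where
  carrier := Set.range (position l)
  one_mem' := ⟨0, funext fun k => (CSign.ofComplex_eq_one_iff _).2 (map_zero (l k))⟩
  mul_mem' := by
    rintro _ _ ⟨z, rfl⟩ ⟨w, rfl⟩
    obtain ⟨ε, hε⟩ := (Filter.eventually_all.2 fun k =>
      CSign.eventually_ofComplex (l k z) (l k w)).exists
    exact ⟨z + (ε : ℂ) • w, funext fun k => by simpa [position] using hε k⟩

/-- The span map: the intersection of all subspaces in the augmented arrangement that contain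
the cone of points with position vector `Z`. -/
noncomputable def spanMap (Z : faces l) : AugLattice l :=
  ⟨⨅ k ∈ {k | position l ⁻¹' {(Z : Fin t → CSign)} ⊆ augmented l k}, augmented l k, _, rfl⟩

theorem spanMap_le_iff (Z : faces l) (X : AugLattice l) :
    spanMap l Z ≤ X ↔ ∀ z, position l z = Z → z ∈ (X : Submodule ℝ (Fin d → ℂ)) := by
  obtain ⟨_, s, rfl⟩ := X
  constructor
  · intro h z hz
    refine (show (spanMap l Z : Submodule ℝ (Fin d → ℂ)) ≤ _ from h) ?_
    simp only [spanMap, Submodule.mem_iInf]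
    exact fun k hk => hk hz
  · intro h
    change (spanMap l Z : Submodule ℝ (Fin d → ℂ)) ≤ ⨅ k ∈ s, augmented l k
    refine le_iInf₂ fun k hk => iInf₂_le k fun z hz => ?_
    have := h z hz
    simp only [Submodule.mem_iInf] at this
    exact this k hk

theorem mem_augmented_inl (k : Fin t) (z : Fin d → ℂ) :
    z ∈ augmented l (.inl k) ↔ position l z k = 1 :=
  (CSign.ofComplex_eq_one_iff _).symm

theorem mem_augmented_inr (k : Fin t) (z : Fin d → ℂ) :
    z ∈ augmented l (.inr k) ↔ (position l z k).height ≤ 1 :=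
  (CSign.height_ofComplex_le_iff _).symm

/-- The fiber semigroup at an element `X` of the augmented intersection lattice. -/
noncomputable def fiber (X : AugLattice l) : Submonoid (faces l) where
  carrier := {Z | spanMap l Z ≤ X}
  one_mem' := by
    obtain ⟨_, s, rfl⟩ := X
    refine (spanMap_le_iff l _ _).2 fun z hz => ?_
    simp only [Submodule.mem_iInf]
    rintro (k | k) -
    · rw [mem_augmented_inl, hz]
      rfl
    · rw [mem_augmented_inr, hz]
      exact Nat.zero_le 1
  mul_mem' := by
    rintro ⟨_, p, rfl⟩ ⟨_, q, rfl⟩ hp hq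
    obtain ⟨_, s, rfl⟩ := X
    have hp' := (spanMap_le_iff l _ _).1 hp p rfl
    have hq' := (spanMap_le_iff l _ _).1 hq q rfl
    refine (spanMap_le_iff l _ _).2 fun z hz => ?_
    replace hz : position l z = position l p * position l q := hz
    simp only [Submodule.mem_iInf] at hp' hq' ⊢
    rintro (k | k) hk
    · have h1 := (mem_augmented_inl l k p).1 (hp' _ hk)
      have h2 := (mem_augmented_inl l k q).1 (hq' _ hk)
      rw [mem_augmented_inl, hz, Pi.mul_apply, h1, h2, one_mul]
    · rw [mem_augmented_inr, hz]
      exact CSign.height_mul_le _ _ ((mem_augmented_inr l k p).1 (hp' _ hk))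
        ((mem_augmented_inr l k q).1 (hq' _ hk))

noncomputable instance (X : AugLattice l) : Fintype (fiber l X) := Fintype.ofFinite _

end Complex

/-! ### Complexified real arrangements -/

section Real

variable {d t : ℕ} (l : Fin t → Module.Dual ℝ (Fin d → ℝ))

/-- The intersection lattice of a real arrangement. -/
abbrev IntersectionLattice : Type := intersections fun k => LinearMap.ker (l k)

/-- The complex linear forms with the same (real) coefficients as the given real ones. -/
noncomputable def complexify : Fin t → Module.Dual ℂ (Fin d → ℂ) :=
  fun k => ∑ m, ((l k (Pi.single m 1) : ℝ) : ℂ) • LinearMap.proj m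

/-- The subspace `{x + i y | x ∈ β, y ∈ α}` of `ℂ^d`. -/
noncomputable def intervalSpace (α β : Submodule ℝ (Fin d → ℝ)) : Submodule ℝ (Fin d → ℂ) :=
  α.comap (Complex.imLm.compLeft (Fin d)) ⊓ β.comap (Complex.reLm.compLeft (Fin d))

theorem complexify_apply (k : Fin t) (z : Fin d → ℂ) :
    complexify l k z = (l k fun m => (z m).re : ℝ) + (l k fun m => (z m).im : ℝ) * Complex.I := by
  have h : ∀ x : Fin d → ℝ, l k x = ∑ m, l k (Pi.single m 1) * x m := fun x => by
    conv_lhs => rw [pi_eq_sum_univ' x]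
    simp [mul_comm]
  rw [h, h]
  simp only [complexify, LinearMap.sum_apply, LinearMap.smul_apply, LinearMap.proj_apply,
    smul_eq_mul]
  push_cast
  rw [Finset.sum_mul, ← Finset.sum_add_distrib]
  refine Finset.sum_congr rfl fun m _ => ?_
  conv_lhs => rw [← Complex.re_add_im (z m)]
  ring

theorem mem_intervalSpace (α β : Submodule ℝ (Fin d → ℝ)) (z : Fin d → ℂ) :
    z ∈ intervalSpace α β ↔ (fun m => (z m).im) ∈ α ∧ (fun m => (z m).re) ∈ β :=
  Iff.rfl

theorem mem_augmented_complexify_inl (k : Fin t) (z : Fin d → ℂ) :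
    z ∈ augmented (complexify l) (.inl k) ↔
      (l k fun m => (z m).im) = 0 ∧ (l k fun m => (z m).re) = 0 := by
  change complexify l k z = 0 ↔ _
  rw [complexify_apply, Complex.ext_iff]
  simp [and_comm]

theorem mem_augmented_complexify_inr (k : Fin t) (z : Fin d → ℂ) :
    z ∈ augmented (complexify l) (.inr k) ↔ (l k fun m => (z m).im) = 0 := by
  change (complexify l k z).im = 0 ↔ _
  rw [complexify_apply]
  simp

theorem intervalSpace_le_iff (α β α' β' : Submodule ℝ (Fin d → ℝ)) :
    intervalSpace α β ≤ intervalSpace α' β' ↔ α ≤ α' ∧ β ≤ β' := by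
  constructor
  · intro h
    constructor
    · intro y hy
      have := @h (fun m => y m * Complex.I) (by
        rw [mem_intervalSpace]
        simpa using ⟨hy, β.zero_mem⟩)
      simpa using ((mem_intervalSpace _ _ _).1 this).1
    · intro x hx
      have := @h (fun m => x m) (by
        rw [mem_intervalSpace]
        simpa using ⟨α.zero_mem, hx⟩)
      simpa using ((mem_intervalSpace _ _ _).1 this).2
  · exact fun h z hz => ⟨h.1 hz.1, h.2 hz.2⟩

theorem intervalSpace_mem (J : Intervals (IntersectionLattice l)) :
    intervalSpace J.1.1 J.1.2 ∈ intersections (augmented (complexify l)) := by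
  obtain ⟨⟨⟨_, s, rfl⟩, ⟨_, u, rfl⟩⟩, h⟩ := J
  refine ⟨{k | Sum.elim (· ∈ u) (· ∈ s) k}, ?_⟩
  ext z
  have h' : ∀ y : Fin d → ℝ, (∀ k ∈ s, l k y = 0) → ∀ k ∈ u, l k y = 0 := fun y hy => by
    have := @h y (by simpa using hy)
    simpa using this
  simp only [Submodule.mem_iInf, mem_intervalSpace, LinearMap.mem_ker, Set.mem_ofPred_eq,
    Sum.forall, Sum.elim_inl, Sum.elim_inr, mem_augmented_complexify_inl,
    mem_augmented_complexify_inr]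
  exact ⟨fun hz => ⟨hz.2, fun k hk => (hz.1 k hk).2⟩,
    fun hz => ⟨fun k hk => ⟨h' _ hz.1 k hk, hz.2 k hk⟩, hz.1⟩⟩

theorem exists_intervalSpace_eq (X : AugLattice (complexify l)) :
    ∃ J : Intervals (IntersectionLattice l), intervalSpace J.1.1 J.1.2 = (X : Submodule ℝ (Fin d → ℂ)) := by
  obtain ⟨_, s, rfl⟩ := X
  refine ⟨⟨(⟨_, {k | .inl k ∈ s ∨ .inr k ∈ s}, rfl⟩, ⟨_, {k | .inl k ∈ s}, rfl⟩), ?_⟩, ?_⟩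
  · exact biInf_mono (f := fun k => LinearMap.ker (l k)) fun k hk => Or.inl hk
  · ext z
    simp only [Submodule.mem_iInf, mem_intervalSpace, LinearMap.mem_ker, Set.mem_ofPred_eq,
      Sum.forall, mem_augmented_complexify_inl, mem_augmented_complexify_inr]
    exact ⟨fun hz => ⟨fun k hk => ⟨hz.1 k (.inl hk), hz.2 k hk⟩, fun k hk => hz.1 k (.inr hk)⟩,
      fun hz => ⟨fun k hk => hk.elim (fun hk => (hz.1 k hk).1) (hz.2 k),
        fun k hk => (hz.1 k hk).2⟩⟩

/-- The isomorphism between the lattice of intervals of the intersection lattice and the augmented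
intersection lattice of the complexification, `[α, β] ↦ {x + i y | x ∈ β, y ∈ α}`. -/
noncomputable def intervalIso : Intervals (IntersectionLattice l) ≃o AugLattice (complexify l) :=
  RelIso.ofSurjective
    (OrderEmbedding.ofMapLEIff (fun J => ⟨intervalSpace J.1.1 J.1.2, intervalSpace_mem l J⟩)
      fun _ _ => intervalSpace_le_iff _ _ _ _)
    fun X => (exists_intervalSpace_eq l X).imp fun _ h => Subtype.ext h

/-- The interval `[π, ⊤]`. -/
def upperInterval (π : IntersectionLattice l) : Intervals (IntersectionLattice l) := ⟨(π, ⊤), le_top⟩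

variable {l} in
/-- The eigenvalue `ε_J` of the walk on the fiber semigroup at `X` driven by `w`: the total weight
of the elements whose support is at most the element of the augmented intersection lattice that
corresponds to the interval `J`. -/
noncomputable def eigenvalue {X : AugLattice (complexify l)} (w : fiber (complexify l) X → ℝ)
    (J : Intervals (IntersectionLattice l)) : ℝ :=
  open Classical in
  ∑ y : fiber (complexify l) X with spanMap (complexify l) y.1 ≤ intervalIso l J, w y

variable {l} in
/-- The number `|μ(α, π) μ(β, ⊤)|` for `J = [α, β]`. -/
noncomputable def intervalMultiplicity (π : IntersectionLattice l) (J : Intervals (IntersectionLattice l)) : ℕ :=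
  (moebius J.1.1 π * moebius J.1.2 ⊤).natAbs

end Real

noncomputable instance {M : Type*} [Monoid M] [Finite M] : Fintype (maxElements M) :=
  Fintype.ofFinite _

noncomputable instance {α : Type*} [PartialOrder α] [Finite α] : Fintype (Intervals α) :=
  Fintype.ofFinite _

end HypArr

open HypArr

namespace HypArr

open Matrix Polynomial

/-! ### Linear algebra: diagonalizability and spectrum from annihilating polynomials and traces. -/

section Spectrum

variable {n : Type*} [Fintype n]

/-! The fiber semigroup is a left regular band: `xyx = xy` holds sign by sign. Writing `A_x` for the
0-1 matrix of left multiplication by `x` on the maximal elements, `P = ∑ w_x A_x` and `A_x A_y =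
A_{yx}`. Everything about `P` follows from this rule.

Diagonalizability: let `ev y` be the total weight of the `x` with `yx = y`. Then `(P - ev y) A_y` is
a combination of matrices `A_{yx}` with `ev (yx) > ev y`. Iterating from `y = 1` shows that a
product of distinct real factors `P - r` vanishes (`isDiagonalizable_transitionMatrix`).

Multiplicities: the trace of `A_x` is the number of maximal elements fixed by `x`. If this number is
a nonnegative integer combination of multiplicative characters `χ_i`, then the trace of `P ^ k` is
the same combination of the powers `(∑ w_x χ_i(x)) ^ k`, and power sums determine a spectrum
(`charpoly_transitionMatrix`).

Fixed points: an element is given by a point `x + iy` with `y ∈ π`. A maximal element is a chamber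
of the restriction to `π` (around `y`) together with a chamber of the localization at `π` (around
`x`), chosen independently. Those fixed by a given element are counted by a product of two chamber
numbers (`card_fixed_maxElements`). Zaslavsky's theorem turns the factors into sums of `|μ(α, π)|`
over `α ≤ π` containing `y` and of `|μ(β, ⊤)|` over `β ≥ π` containing `x`. These two conditions say
that the support is at most `[α, β]`, which is a character of the semigroup. By Rota's sign theorem
no multiplicity is zero, so every pair does give an eigenvalue.

Stationarity: if the steps of positive weight generate, any maximal `e` is reached from any `c`,
since `ec = e`. The chain is thus irreducible. -/

theorem isDiagonalizable_of_span_eigenvectors [DecidableEq n] (P : Matrix n n ℝ)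
    (h : ⊤ ≤ Submodule.span ℝ {v : n → ℝ | ∃ r : ℝ, P *ᵥ v = r • v}) : IsDiagonalizable P := by
  classical
  let b := Module.Basis.ofSpan h
  have hb : ∀ i, ∃ r : ℝ, P *ᵥ b i = r • b i := fun i =>
    Module.Basis.ofSpan_subset h ⟨i, rfl⟩
  have : Fintype ((linearIndepOn_empty ℝ (id : (n → ℝ) → n → ℝ)).extend
      (Set.empty_subset {v : n → ℝ | ∃ r : ℝ, P *ᵥ v = r • v})) :=
    FiniteDimensional.fintypeBasisIndex b
  have e := Fintype.equivOfCardEq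
    ((Module.finrank_eq_card_basis b).symm.trans (Module.finrank_fintype_fun_eq_card ℝ (η := n)))
  let b' := b.reindex e
  have hb' : ∀ i, ∃ r : ℝ, P *ᵥ b' i = r • b' i := fun i => by
    simpa [b'] using hb (e.symm i)
  choose D hD using hb'
  refine ⟨(Pi.basisFun ℝ n).toMatrix b', D, ?_, ?_⟩
  · exact @isUnit_of_invertible _ _ _ ((Pi.basisFun ℝ n).invertibleToMatrix b')
  · ext i j
    have := congrFun (hD j) i
    simpa [Matrix.mul_apply, mulVec, dotProduct, Module.Basis.toMatrix_apply, diagonal_apply, mul_comm] using this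

/-- The Lagrange basis polynomials of `R` sum to 1, and `X - r` times the one at `r` is a multiple
of the annihilating polynomial. Evaluated at `P`, they split each vector into eigenvectors. -/
theorem isDiagonalizable_of_aeval_prod_eq_zero [DecidableEq n] (P : Matrix n n ℝ) (R : Finset ℝ)
    (h : aeval P (∏ r ∈ R, (X - C r)) = 0) : IsDiagonalizable P := by
  refine isDiagonalizable_of_span_eigenvectors P fun v _ => ?_
  have key : ∀ r ∈ R, (P * aeval P (Lagrange.basis R id r)) = r • aeval P (Lagrange.basis R id r) := by
    intro r hr
    have h1 : (X - C r) * Lagrange.basis R id r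
        = (∏ j ∈ R.erase r, C ((r - j)⁻¹)) * ∏ r ∈ R, (X - C r) := by
      rw [Lagrange.basis, ← Finset.mul_prod_erase R (fun r => X - C r) hr]
      simp only [Lagrange.basisDivisor, Finset.prod_mul_distrib, id]
      ring
    have h2 := congrArg (aeval P) h1
    rw [map_mul, map_mul, h, mul_zero, map_sub, aeval_X, aeval_C, sub_mul, sub_eq_zero] at h2
    rw [h2, Algebra.algebraMap_eq_smul_one, smul_mul_assoc, one_mul]
  rcases R.eq_empty_or_nonempty with rfl | hR
  · have h1 : (1 : Matrix n n ℝ) = 0 := by simpa using h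
    have : v = 0 := by rw [← one_mulVec v, h1, zero_mulVec]
    rw [this]; exact zero_mem _
  · have h1 : ∑ r ∈ R, aeval P (Lagrange.basis R id r) = 1 := by
      rw [← map_sum, Lagrange.sum_basis Function.injective_id.injOn hR, map_one]
    have h2 : v = ∑ r ∈ R, aeval P (Lagrange.basis R id r) *ᵥ v := by
      rw [← Matrix.sum_mulVec, h1, one_mulVec]
    rw [h2]
    refine Submodule.sum_mem _ fun r hr => Submodule.subset_span ⟨r, ?_⟩
    rw [mulVec_mulVec, key r hr, smul_mulVec]

/-- Two finite families of real points, the second with multiplicities, that have the same power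
sums agree as multisets. -/
theorem prod_X_sub_C_eq_of_sum_pow_eq {ι : Type*} (s : Finset ι) (D : n → ℝ) (a : ι → ℝ) (m : ι → ℕ)
    (h : ∀ k : ℕ, ∑ j, D j ^ k = ∑ i ∈ s, (m i : ℝ) * a i ^ k) :
    ∏ j, (X - C (D j)) = ∏ i ∈ s, (X - C (a i)) ^ m i := by
  classical
  -- By linearity the two families agree on all polynomials; the Lagrange polynomial at `r` then
  -- counts the occurrences of `r` in each.
  have hp : ∀ p : ℝ[X], ∑ j, p.eval (D j) = ∑ i ∈ s, (m i : ℝ) * p.eval (a i) := by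
    intro p
    induction p using Polynomial.induction_on' with
    | add p q hp hq => simp [Finset.sum_add_distrib, mul_add, hp, hq]
    | monomial k c =>
      simp only [eval_monomial]
      rw [← Finset.mul_sum, h, Finset.mul_sum]
      exact Finset.sum_congr rfl fun _ _ => by ring
  let R : Finset ℝ := Finset.univ.image D ∪ s.image a
  have hD : ∀ j ∈ Finset.univ, D j ∈ R := fun j _ =>
    Finset.mem_union_left _ (Finset.mem_image_of_mem _ (Finset.mem_univ j))
  have ha : ∀ i ∈ s, a i ∈ R := fun i hi => Finset.mem_union_right _ (Finset.mem_image_of_mem _ hi)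
  have ev : ∀ r ∈ R, ∀ x ∈ R, (Lagrange.basis R id r).eval x = if x = r then 1 else 0 := by
    intro r hr x hx
    split_ifs with hxr
    · subst hxr; exact Lagrange.eval_basis_self Function.injective_id.injOn hr
    · exact Lagrange.eval_basis_of_ne (v := id) (Ne.symm hxr) hx
  rw [← Finset.prod_fiberwise_of_maps_to hD, ← Finset.prod_fiberwise_of_maps_to ha]
  refine Finset.prod_congr rfl fun r hr => ?_
  have h1 : ∏ j with D j = r, (X - C (D j)) = (X - C r) ^ (Finset.univ.filter (D · = r)).card := by
    rw [← Finset.prod_const]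
    exact Finset.prod_congr rfl fun j hj => by rw [(Finset.mem_filter.1 hj).2]
  have h2 : ∏ i ∈ s with a i = r, (X - C (a i)) ^ m i = (X - C r) ^ (∑ i ∈ s with a i = r, m i) := by
    rw [← Finset.prod_pow_eq_pow_sum]
    exact Finset.prod_congr rfl fun j hj => by rw [(Finset.mem_filter.1 hj).2]
  rw [h1, h2]
  congr 1
  have h3 := hp (Lagrange.basis R id r)
  rw [Finset.sum_congr rfl fun j hj => ev r hr _ (hD j hj),
    Finset.sum_congr rfl fun i hi => congrArg ((m i : ℝ) * ·) (ev r hr _ (ha i hi))] at h3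
  simp only [mul_ite, mul_one, mul_zero, ← Finset.sum_filter] at h3
  rw [Finset.card_eq_sum_ones]
  exact_mod_cast h3

theorem charpoly_of_isDiagonalizable [DecidableEq n] {P : Matrix n n ℝ} (hP : IsDiagonalizable P) {ι : Type*}
    (s : Finset ι) (a : ι → ℝ) (m : ι → ℕ)
    (h : ∀ k : ℕ, (P ^ k).trace = ∑ i ∈ s, (m i : ℝ) * a i ^ k) :
    P.charpoly = ∏ i ∈ s, (X - C (a i)) ^ m i := by
  obtain ⟨Q, D, ⟨Q, rfl⟩, hQ⟩ := hP
  have hP : P = Q * diagonal D * (↑Q⁻¹ : Matrix n n ℝ) := by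
    rw [← hQ, mul_assoc, Units.mul_inv, mul_one]
  have hpow : ∀ k : ℕ, P ^ k = Q * diagonal D ^ k * (↑Q⁻¹ : Matrix n n ℝ) := fun k => by
    rw [hP, ← Units.conj_pow]
  rw [hP, Matrix.coe_units_inv, Matrix.charpoly_units_conj Q, charpoly_diagonal]
  refine prod_X_sub_C_eq_of_sum_pow_eq s D a m fun k => ?_
  rw [← h, hpow, Matrix.trace_mul_cycle, Units.inv_mul, one_mul, diagonal_pow, trace_diagonal]
  rfl

end Spectrum

/-! ### Random walks on left regular bands. -/

section Band

variable {M : Type*} [Monoid M]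

/-- The identity `xyx = xy` of left regular bands. -/
def IsLeftRegularBand (M : Type*) [Monoid M] : Prop :=
  ∀ x y : M, x * y * x = x * y

theorem IsLeftRegularBand.mul_self (hM : IsLeftRegularBand M) (x : M) : x * x = x := by
  simpa using hM x 1

theorem mul_eq_of_mem_maxElements (hM : IsLeftRegularBand M) {c : M}
    (hc : c ∈ maxElements M) (x : M) : c * x = c := by
  have h := hM.mul_self c
  exact hc (c * x) (by rw [← mul_assoc, h])

theorem mul_mem_maxElements (hM : IsLeftRegularBand M) {c : M} (hc : c ∈ maxElements M)
    (x : M) : x * c ∈ maxElements M := fun y hy => by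
  rw [mul_assoc, mul_eq_of_mem_maxElements hM hc] at hy
  exact hy.symm

theorem exists_mem_maxElements [Finite M] (hM : IsLeftRegularBand M) :
    ∃ c, c ∈ maxElements M := by
  -- `r x y` says that `x` lies strictly above `y`, so an `r`-minimal element is maximal in the
  -- band.
  let r : M → M → Prop := fun x y => y * x = x ∧ x ≠ y
  have : IsTrans M r := ⟨fun x y z hxy hyz => ⟨by rw [← hxy.1, ← mul_assoc, hyz.1], by
    rintro rfl
    have h := hM x y
    rw [hyz.1, hxy.1] at h
    exact hxy.2 h⟩⟩
  have : Std.Irrefl r := ⟨fun x hx => hx.2 rfl⟩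
  obtain ⟨c, -, hc⟩ := (Finite.wellFounded_of_trans_of_irrefl r).has_min Set.univ ⟨1, trivial⟩
  exact ⟨c, fun x hx => by_contra fun h => hc x trivial ⟨hx, h⟩⟩

open Classical in
/-- The matrix of left multiplication by `x` on the maximal elements. -/
noncomputable def actionMatrix (x : M) : Matrix (maxElements M) (maxElements M) ℝ :=
  Matrix.of fun c d => if x * (c : M) = d then 1 else 0

theorem actionMatrix_apply (x : M) (c d : maxElements M) [Decidable (x * (c : M) = d)] :
    actionMatrix x c d = if x * (c : M) = d then 1 else 0 := by
  unfold actionMatrix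
  rw [Matrix.of_apply]
  congr

theorem actionMatrix_one [DecidableEq (maxElements M)] : actionMatrix (1 : M) = 1 := by
  classical
  ext c d
  rw [actionMatrix_apply]
  simp [Matrix.one_apply, Subtype.ext_iff]

variable [Fintype M]

theorem transitionMatrix_eq_sum (w : M → ℝ) :
    transitionMatrix w = ∑ x, w x • actionMatrix x := by
  classical
  ext c d
  simp [transitionMatrix, actionMatrix_apply, Matrix.sum_apply, Finset.sum_filter]

/-- The order is reversed because rows index the starting point: the left factor acts first. -/
theorem actionMatrix_mul (hM : IsLeftRegularBand M) (x y : M) :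
    actionMatrix x * actionMatrix y = actionMatrix (y * x) := by
  classical
  ext c d
  rw [Matrix.mul_apply, Finset.sum_eq_single ⟨x * c, mul_mem_maxElements hM c.2 x⟩]
  · simp [actionMatrix_apply, mul_assoc]
  · intro e _ he
    have : x * (c : M) ≠ e := fun h => he (Subtype.ext h.symm)
    simp [actionMatrix_apply, this]
  · simp

/-- `P` is triangular along the values `ev y`: apart from the term `ev y • A_y`, multiplying `A_y`
by `P` gives only `A_{yx}` of strictly larger value. Nonnegative weights make the value monotone. -/
theorem isDiagonalizable_transitionMatrix [DecidableEq (maxElements M)]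
    (hM : IsLeftRegularBand M) (w : M → ℝ)
    (hw : ∀ x, 0 ≤ w x) : IsDiagonalizable (transitionMatrix w) := by
  classical
  set P := transitionMatrix w with hP
  let ev : M → ℝ := fun y => ∑ x with y * x = y, w x
  have step : ∀ y : M, (P - algebraMap ℝ _ (ev y)) * actionMatrix y
      = ∑ x with ¬ y * x = y, w x • actionMatrix (y * x) := fun y => by
    have h1 : P * actionMatrix y = ∑ x, w x • actionMatrix (y * x) := by
      rw [hP, transitionMatrix_eq_sum, Finset.sum_mul]
      exact Finset.sum_congr rfl fun x _ => by rw [smul_mul_assoc, actionMatrix_mul hM]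
    rw [sub_mul, h1, ← Finset.sum_filter_add_sum_filter_not _ (fun x => y * x = y),
      Finset.sum_congr rfl fun x hx => by rw [(Finset.mem_filter.1 hx).2], ← Finset.sum_smul,
      Algebra.algebraMap_eq_smul_one, smul_mul_assoc, one_mul, add_sub_cancel_left]
  have mono : ∀ y x, ¬ y * x = y → w x ≠ 0 → ev y < ev (y * x) := fun y x hyx hx => by
    refine Finset.sum_lt_sum_of_subset (i := x) (fun z hz => ?_) ?_ ?_ ?_ fun z _ _ => hw z
    · rw [Finset.mem_filter] at hz ⊢
      refine ⟨Finset.mem_univ _, ?_⟩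
      -- If `yz = y`, then `yxz = yzxz = yzx = yx`, so everything absorbed by `y` is absorbed by
      -- `yx`; moreover `x` itself is newly absorbed.
      have h := congrArg (y * ·) (hM z x)
      simpa only [← mul_assoc, hz.2] using h
    · simpa [mul_assoc] using congrArg (y * ·) (hM.mul_self x)
    · simpa using hyx
    · exact (hw x).lt_of_ne' hx
  let R : Finset ℝ := Finset.univ.image ev
  -- Induction on the number of values at least `ev y`: the factor at `ev y` passes to strictly
  -- larger values, whose factors all remain in the product.
  have main : ∀ (k : ℕ) (y : M), (R.filter (ev y ≤ ·)).card ≤ k →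
      aeval P (∏ r ∈ R with ev y ≤ r, (X - C r)) * actionMatrix y = 0 := by
    intro k
    induction k with
    | zero =>
      intro y hy
      have : ev y ∈ R.filter (ev y ≤ ·) := by simp [R]
      rw [Finset.card_eq_zero.1 (Nat.le_zero.1 hy)] at this
      simp at this
    | succ k ih =>
      intro y hy
      have hmem : ev y ∈ R.filter (ev y ≤ ·) := by simp [R]
      rw [← Finset.mul_prod_erase _ _ hmem, mul_comm, map_mul, mul_assoc, map_sub, aeval_X, aeval_C,
        step, Finset.mul_sum]
      refine Finset.sum_eq_zero fun x hx => ?_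
      rw [mul_smul_comm]
      by_cases hx0 : w x = 0
      · rw [hx0, zero_smul]
      have hlt := mono y x (Finset.mem_filter.1 hx).2 hx0
      have hsub : R.filter (ev (y * x) ≤ ·) ⊆ (R.filter (ev y ≤ ·)).erase (ev y) := fun r hr => by
        simp only [Finset.mem_filter, Finset.mem_erase] at hr ⊢
        exact ⟨(hlt.trans_le hr.2).ne', hr.1, hlt.le.trans hr.2⟩
      have hcard := Finset.card_le_card hsub
      rw [Finset.card_erase_of_mem hmem] at hcard
      rw [← Finset.prod_sdiff hsub, map_mul, mul_assoc, ih _ (by omega), mul_zero, smul_zero]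
  have h1 := main _ 1 le_rfl
  rw [actionMatrix_one, mul_one] at h1
  exact isDiagonalizable_of_aeval_prod_eq_zero P _ h1

/-- The characteristic polynomial of the walk, when the number of fixed points of each element on
the maximal elements is a combination of multiplicative characters. -/
theorem charpoly_transitionMatrix [DecidableEq (maxElements M)]
    (hM : IsLeftRegularBand M) (w : M → ℝ) (hw : ∀ x, 0 ≤ w x) {ι : Type*} (s : Finset ι) (χ : ι → M →* ℝ) (m : ι → ℕ)
    (h : ∀ x : M, (Nat.card {c : maxElements M // x * c = c} : ℝ) = ∑ i ∈ s, (m i : ℝ) * χ i x) :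
    (transitionMatrix w).charpoly = ∏ i ∈ s, (X - C (∑ x, w x * χ i x)) ^ m i := by
  classical
  refine charpoly_of_isDiagonalizable (isDiagonalizable_transitionMatrix hM w hw) _ _ _ ?_
  -- The extra factor `A_v` makes the induction close: one `P` is absorbed into it, replacing `v` by
  -- `vx`, and `χ i (vx) = χ i v * χ i x` brings out one factor of the eigenvalue.
  have main : ∀ (k : ℕ) (v : M), (transitionMatrix w ^ k * actionMatrix v).trace
      = ∑ i ∈ s, (m i : ℝ) * ((∑ x, w x * χ i x) ^ k * χ i v) := by
    intro k
    induction k with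
    | zero =>
      intro v
      simp only [pow_zero, one_mul, ← h, Nat.card_eq_fintype_card, Fintype.card_subtype]
      simp [Matrix.trace, actionMatrix_apply]
    | succ k ih =>
      intro v
      have : transitionMatrix w ^ (k + 1) * actionMatrix v
          = ∑ x, w x • (transitionMatrix w ^ k * actionMatrix (v * x)) := by
        rw [pow_succ, mul_assoc]
        conv_lhs => rw [transitionMatrix_eq_sum (w := w), Finset.sum_mul, ← transitionMatrix_eq_sum]
        rw [Finset.mul_sum]
        exact Finset.sum_congr rfl fun x _ => by
          rw [smul_mul_assoc, actionMatrix_mul hM, mul_smul_comm]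
      rw [this, Matrix.trace_sum]
      simp only [Matrix.trace_smul, ih, map_mul, smul_eq_mul, Finset.mul_sum]
      rw [Finset.sum_comm]
      refine Finset.sum_congr rfl fun i _ => ?_
      rw [pow_succ, Finset.mul_sum, Finset.sum_mul, Finset.mul_sum]
      exact Finset.sum_congr rfl fun x _ => by ring
  intro k
  simpa [actionMatrix_one] using main k 1

end Band

end HypArr

namespace HypArr

open Matrix

/-! ### Stationary distributions of stochastic matrices. -/

section Stationary

variable {n : Type*} [Fintype n] {P : Matrix n n ℝ}

theorem sum_vecMul_of_rowSum_eq_one (h1 : ∀ c, ∑ e, P c e = 1) (u : n → ℝ) :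
    ∑ e, (u ᵥ* P) e = ∑ c, u c := by
  simp only [vecMul, dotProduct]
  rw [Finset.sum_comm]
  simp only [← Finset.mul_sum, h1, mul_one]

/-- The triangle inequality gives `|u| ≤ |u| P` entrywise; both sides have the same total, so
equality holds everywhere. -/
theorem abs_vecMul_eq_of_vecMul_eq (h0 : ∀ c e, 0 ≤ P c e) (h1 : ∀ c, ∑ e, P c e = 1) {u : n → ℝ}
    (hu : u ᵥ* P = u) : |u| ᵥ* P = |u| := by
  have hle : ∀ e ∈ Finset.univ, |u| e ≤ (|u| ᵥ* P) e := fun e _ => by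
    rw [Pi.abs_apply]
    conv_lhs => rw [← hu]
    refine (Finset.abs_sum_le_sum_abs _ _).trans_eq ?_
    exact Finset.sum_congr rfl fun c _ => by rw [abs_mul, abs_of_nonneg (h0 c e)]; rfl
  have := (Finset.sum_eq_sum_iff_of_le hle).1 (sum_vecMul_of_rowSum_eq_one h1 |u|).symm
  exact funext fun e => (this e (Finset.mem_univ e)).symm

theorem exists_ne_zero_vecMul_eq [Nonempty n] (h1 : ∀ c, ∑ e, P c e = 1) :
    ∃ u : n → ℝ, u ≠ 0 ∧ u ᵥ* P = u := by
  classical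
  -- The constant vector shows that `P - 1` is singular, hence it also has a left kernel.
  have h : ∃ v : n → ℝ, v ≠ 0 ∧ (P - 1) *ᵥ v = 0 :=
    ⟨1, one_ne_zero, by rw [sub_mulVec, one_mulVec]; ext c; simp [mulVec, dotProduct, h1]⟩
  obtain ⟨u, hu, h⟩ := exists_vecMul_eq_zero_iff.2 (exists_mulVec_eq_zero_iff.1 h)
  exact ⟨u, hu, by rwa [vecMul_sub, vecMul_one, sub_eq_zero] at h⟩

/-- An irreducible stochastic matrix has a unique stationary distribution. Here irreducibility is
only used in the form that nonzero stationary vectors are positive. -/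
theorem existsUnique_stationary [Nonempty n] (h0 : ∀ c e, 0 ≤ P c e) (h1 : ∀ c, ∑ e, P c e = 1)
    (hpos : ∀ v : n → ℝ, (∀ c, 0 ≤ v c) → v ᵥ* P = v → ∀ c, 0 < v c → ∀ e, 0 < v e) :
    ∃! p : n → ℝ, p ∈ stdSimplex ℝ n ∧ p ᵥ* P = p := by
  obtain ⟨u, hu, hP⟩ := exists_ne_zero_vecMul_eq h1
  obtain ⟨c, hc⟩ := Function.ne_iff.1 hu
  have hs : 0 < ∑ c, |u| c :=
    Finset.sum_pos' (fun c _ => abs_nonneg _) ⟨c, Finset.mem_univ c, abs_pos.2 hc⟩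
  refine ⟨(∑ c, |u| c)⁻¹ • |u|, ⟨⟨fun c => ?_, ?_⟩, ?_⟩, ?_⟩
  · exact mul_nonneg (inv_nonneg.2 hs.le) (abs_nonneg _)
  · simp only [Pi.smul_apply, smul_eq_mul, ← Finset.mul_sum]
    exact inv_mul_cancel₀ hs.ne'
  · rw [smul_vecMul, abs_vecMul_eq_of_vecMul_eq h0 h1 hP]
  have huniq : ∀ p q : n → ℝ, (p ∈ stdSimplex ℝ n ∧ p ᵥ* P = p) →
      (q ∈ stdSimplex ℝ n ∧ q ᵥ* P = q) → p ≤ q := by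
    rintro p q ⟨hp, hpP⟩ ⟨hq, hqP⟩
    by_contra hle
    obtain ⟨c, hc⟩ : ∃ c, q c < p c := by simpa [Pi.le_def] using hle
    have hsum : ∑ c, (p c - q c) = 0 := by rw [Finset.sum_sub_distrib, hp.2, hq.2, sub_self]
    obtain ⟨e, he⟩ : ∃ e, p e - q e < 0 := by
      by_contra! h
      have := (Finset.sum_eq_zero_iff_of_nonneg fun e _ => h e).1 hsum c (Finset.mem_univ c)
      linarith
    have hst : (p - q) ᵥ* P = p - q := by rw [sub_vecMul, hpP, hqP]
    -- Twice the positive part of `p - q` is stationary and nonnegative, positive at `c` but zero at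
    -- `e`, against `hpos`.
    have hst' : (|p - q| + (p - q)) ᵥ* P = |p - q| + (p - q) := by
      rw [add_vecMul, hst, abs_vecMul_eq_of_vecMul_eq h0 h1 hst]
    have := hpos _ (fun c => ?_) hst' c ?_ e
    · simp only [Pi.add_apply, Pi.abs_apply, Pi.sub_apply, abs_of_neg he] at this
      linarith
    · simp only [Pi.add_apply, Pi.abs_apply, Pi.sub_apply]
      linarith [neg_abs_le (p c - q c)]
    · simp only [Pi.add_apply, Pi.abs_apply, Pi.sub_apply]
      linarith [abs_nonneg (p c - q c)]
  refine fun q hq => le_antisymm (huniq _ _ hq ?_) (huniq _ _ ?_ hq)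
  all_goals
    refine ⟨⟨fun c => mul_nonneg (inv_nonneg.2 hs.le) (abs_nonneg _), ?_⟩, ?_⟩
    · simp only [Pi.smul_apply, smul_eq_mul, ← Finset.mul_sum]
      exact inv_mul_cancel₀ hs.ne'
    · rw [smul_vecMul, abs_vecMul_eq_of_vecMul_eq h0 h1 hP]

end Stationary

theorem existsUnique_stationary_transitionMatrix {M : Type*} [Monoid M] [Fintype M]
    (hM : IsLeftRegularBand M) {w : M → ℝ} (hw : w ∈ stdSimplex ℝ M)
    (hgen : Submonoid.closure {x | 0 < w x} = ⊤) :
    ∃! p : maxElements M → ℝ, p ∈ stdSimplex ℝ (maxElements M) ∧ p ᵥ* transitionMatrix w = p := by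
  classical
  obtain ⟨c₀, hc₀⟩ := exists_mem_maxElements hM
  have : Nonempty (maxElements M) := ⟨⟨c₀, hc₀⟩⟩
  have h0 : ∀ c e, 0 ≤ transitionMatrix w c e := fun c e => Finset.sum_nonneg fun x _ => hw.1 x
  have hrow : ∀ c, ∑ e, transitionMatrix w c e = 1 := fun c => by
    rw [← hw.2, transitionMatrix_eq_sum]
    simp only [Matrix.sum_apply, Matrix.smul_apply, actionMatrix_apply, smul_eq_mul]
    rw [Finset.sum_comm]
    refine Finset.sum_congr rfl fun x _ => ?_
    rw [Finset.sum_eq_single ⟨x * c, mul_mem_maxElements hM c.2 x⟩]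
    · simp
    · intro e _ he
      rw [if_neg fun h => he (Subtype.ext h.symm), mul_zero]
    · simp
  refine existsUnique_stationary h0 hrow fun v hv hvP c hc e => ?_
  have step : ∀ x, 0 < w x → ∀ c, 0 < v c →
      0 < v ⟨x * c, mul_mem_maxElements hM c.2 x⟩ := fun x hx c hc => by
    rw [← hvP]
    refine Finset.sum_pos' (fun c _ => mul_nonneg (hv c) (h0 _ _))
      ⟨c, Finset.mem_univ c, mul_pos hc ?_⟩
    exact Finset.sum_pos' (fun x _ => hw.1 x) ⟨x, by simp, hx⟩
  have all : ∀ x : M, ∀ c, 0 < v c → 0 < v ⟨x * c, mul_mem_maxElements hM c.2 x⟩ := fun x => by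
    have hx : x ∈ Submonoid.closure {x | 0 < w x} := hgen ▸ Submonoid.mem_top x
    induction hx using Submonoid.closure_induction with
    | mem x hx => exact step x hx
    | one => intro c hc; simpa using hc
    | mul x y _ _ hx hy => intro c hc; simpa only [mul_assoc] using hx _ (hy c hc)
  -- Acting by `e` itself sends every `c` to `e * c = e`.
  simpa only [mul_eq_of_mem_maxElements hM e.2] using all e c hc

end HypArr

namespace HypArr

open Finset Module

/-! ### Chamber counts: deletion and restriction, and Zaslavsky's theorem. -/

section Zaslavsky

variable {V ι : Type*} [AddCommGroup V] [Module ℝ V] (l : ι → Dual ℝ V)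

/-- The intersection of a subspace with the hyperplanes indexed by `S`. -/
def flat (U : Submodule ℝ V) (S : Finset ι) : Submodule ℝ V :=
  U ⊓ ⨅ k ∈ S, LinearMap.ker (l k)

theorem mem_flat {U : Submodule ℝ V} {S : Finset ι} {v : V} :
    v ∈ flat l U S ↔ v ∈ U ∧ ∀ k ∈ S, l k v = 0 := by
  simp [flat]

theorem flat_empty (U : Submodule ℝ V) : flat l U ∅ = U := by
  simp [flat]

theorem flat_anti (U : Submodule ℝ V) {S T : Finset ι} (h : S ⊆ T) : flat l U T ≤ flat l U S :=
  fun _ hv => (mem_flat l).2 ⟨((mem_flat l).1 hv).1, fun k hk => ((mem_flat l).1 hv).2 k (h hk)⟩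

theorem flat_insert [DecidableEq ι] (U : Submodule ℝ V) (S : Finset ι) (a : ι) :
    flat l U (insert a S) = flat l (U ⊓ LinearMap.ker (l a)) S := by
  ext v
  simp [mem_flat, and_assoc]

theorem flat_insert' [DecidableEq ι] (U : Submodule ℝ V) (S : Finset ι) (a : ι) :
    flat l U (insert a S) = flat l U S ⊓ LinearMap.ker (l a) := by
  ext v
  simp only [mem_flat, mem_insert, forall_eq_or_imp, Submodule.mem_inf, LinearMap.mem_ker]
  tauto

theorem finrank_inf_ker_add_one [FiniteDimensional ℝ V] {U : Submodule ℝ V} {f : Dual ℝ V}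
    (h : ¬ U ≤ LinearMap.ker f) : finrank ℝ ↥(U ⊓ LinearMap.ker f) + 1 = finrank ℝ U := by
  have h0 : f ∘ₗ U.subtype ≠ 0 := fun h0 => h fun v hv => by
    simpa using LinearMap.congr_fun h0 ⟨v, hv⟩
  have h1 := Dual.finrank_ker_add_one_of_ne_zero h0
  rw [LinearMap.ker_comp] at h1
  rw [← h1, ← Submodule.map_comap_subtype, Submodule.finrank_map_subtype_eq]

open Classical in
/-- The chambers of the hyperplanes indexed by `A` in the subspace `U`, each recorded by the set of
forms that are positive on it. -/
def chambers (U : Submodule ℝ V) (A : Finset ι) : Set (Finset ι) :=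
  {P | ∃ v ∈ U, (∀ k ∈ A, l k v ≠ 0) ∧ P = {k ∈ A | 0 < l k v}}

open Filter Topology in
theorem exists_pos_forall_perturb (A : Finset ι) (v u : V) : ∃ ε : ℝ, 0 < ε ∧
    ∀ k ∈ A, l k v ≠ 0 → l k (v + ε • u) ≠ 0 ∧ (0 < l k (v + ε • u) ↔ 0 < l k v) := by
  have h : ∀ k ∈ A, ∀ᶠ ε : ℝ in 𝓝[>] 0, l k v ≠ 0 →
      l k (v + ε • u) ≠ 0 ∧ (0 < l k (v + ε • u) ↔ 0 < l k v) := fun k _ => by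
    have hc : Tendsto (fun ε : ℝ => l k (v + ε • u)) (𝓝[>] 0) (𝓝 (l k v)) := by
      have : Continuous fun ε : ℝ => l k v + ε * l k u := by fun_prop
      simpa using (this.tendsto 0).mono_left nhdsWithin_le_nhds
    rcases lt_trichotomy (l k v) 0 with hv | hv | hv
    · filter_upwards [hc.eventually (gt_mem_nhds hv)] with ε hε _
      exact ⟨hε.ne, by simp only [hε.not_gt, hv.not_gt]⟩
    · simp [hv]
    · filter_upwards [hc.eventually (lt_mem_nhds hv)] with ε hε _
      exact ⟨hε.ne', by simp only [hε, hv]⟩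
  obtain ⟨ε, hε, hpos⟩ := (((Finset.eventually_all A).2 h).and self_mem_nhdsWithin).exists
  exact ⟨ε, hpos, hε⟩

theorem finite_chambers (U : Submodule ℝ V) (A : Finset ι) : (chambers l U A).Finite := by
  classical
  refine (A.powerset : Finset (Finset ι)).finite_toSet.subset ?_
  rintro _ ⟨v, -, -, rfl⟩
  exact mem_coe.2 (mem_powerset.2 (filter_subset _ _))

theorem chambers_insert_eq_empty [DecidableEq ι] {U : Submodule ℝ V} (A : Finset ι) {a : ι}
    (h : U ≤ LinearMap.ker (l a)) : chambers l U (insert a A) = ∅ := by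
  refine Set.eq_empty_of_forall_notMem ?_
  rintro _ ⟨v, hv, hne, -⟩
  exact hne a (mem_insert_self a A) (h hv)

/-- Deletion and restriction for the number of chambers. -/
theorem ncard_chambers_insert [DecidableEq ι] {U : Submodule ℝ V} {A : Finset ι} {a : ι}
    (ha : a ∉ A) (h : ¬ U ≤ LinearMap.ker (l a)) :
    (chambers l U (insert a A)).ncard
      = (chambers l U A).ncard + (chambers l (U ⊓ LinearMap.ker (l a)) A).ncard := by
  classical
  obtain ⟨u, hu, hua⟩ := SetLike.not_le_iff_exists.1 h
  replace hua : l a u ≠ 0 := hua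
  obtain ⟨u, hu, hua⟩ : ∃ u ∈ U, 0 < l a u := by
    rcases hua.lt_or_gt with h | h
    · exact ⟨-u, U.neg_mem hu, by simpa using h⟩
    · exact ⟨u, hu, h⟩
  -- `N` and `Q` are the chambers of `A` meeting the negative and the positive side of `l a`. Their
  -- union is all chambers of `A`, their intersection the chambers cut by the hyperplane, and their
  -- disjoint sum the chambers after insertion.
  let N : Set (Finset ι) :=
    {P | ∃ v ∈ U, (∀ k ∈ A, l k v ≠ 0) ∧ l a v < 0 ∧ P = {k ∈ A | 0 < l k v}}
  let Q : Set (Finset ι) :=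
    {P | ∃ v ∈ U, (∀ k ∈ A, l k v ≠ 0) ∧ 0 < l a v ∧ P = {k ∈ A | 0 < l k v}}
  have hNA : ∀ P ∈ N, a ∉ P := by
    rintro _ ⟨v, -, -, -, rfl⟩ h
    exact ha (mem_filter.1 h).1
  have hQA : ∀ P ∈ Q, a ∉ P := by
    rintro _ ⟨v, -, -, -, rfl⟩ h
    exact ha (mem_filter.1 h).1
  have move : ∀ v ∈ U, (∀ k ∈ A, l k v ≠ 0) → ∀ u ∈ U, ∃ ε : ℝ, 0 < ε ∧ v + ε • u ∈ U ∧
      (∀ k ∈ A, l k (v + ε • u) ≠ 0) ∧ {k ∈ A | 0 < l k (v + ε • u)} = {k ∈ A | 0 < l k v} :=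
    fun v hv hne u hu => by
      obtain ⟨ε, hε, h⟩ := exists_pos_forall_perturb l A v u
      exact ⟨ε, hε, U.add_mem hv (U.smul_mem ε hu), fun k hk => (h k hk (hne k hk)).1,
        filter_congr fun k hk => (h k hk (hne k hk)).2⟩
  have hunion : N ∪ Q = chambers l U A := by
    ext P
    constructor
    · rintro (⟨v, hv, hne, -, rfl⟩ | ⟨v, hv, hne, -, rfl⟩) <;> exact ⟨v, hv, hne, rfl⟩
    · rintro ⟨v, hv, hne, rfl⟩
      rcases lt_trichotomy (l a v) 0 with h | h | h
      · exact Or.inl ⟨v, hv, hne, h, rfl⟩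
      · obtain ⟨ε, hε, hU, hne', heq⟩ := move v hv hne u hu
        exact Or.inr ⟨_, hU, hne', by simpa [h] using mul_pos hε hua, heq.symm⟩
      · exact Or.inr ⟨v, hv, hne, h, rfl⟩
  have hinter : N ∩ Q = chambers l (U ⊓ LinearMap.ker (l a)) A := by
    ext P
    constructor
    · rintro ⟨⟨v, hv, hne, hva, rfl⟩, v', hv', hne', hva', heq⟩
      have hs : ∀ k ∈ A, (0 < l k v ↔ 0 < l k v') := fun k hk => by
        simpa [hk] using Finset.ext_iff.1 heq k
      -- Both coefficients are positive, so this combination stays in the common chamber; they are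
      -- chosen so that `l a` vanishes on it.
      have key : ∀ k ∈ A, l k (l a v' • v + (-l a v) • v') ≠ 0 ∧
          (0 < l k v ↔ 0 < l k (l a v' • v + (-l a v) • v')) := fun k hk => by
        have e : l k (l a v' • v + (-l a v) • v') = l a v' * l k v + (-l a v) * l k v' := by simp
        rw [e]
        rcases (hne k hk).lt_or_gt with h | h
        · have h' : l k v' < 0 := (hne' k hk).lt_of_le (not_lt.1 ((hs k hk).not.1 h.not_gt))
          have := add_neg (mul_neg_of_pos_of_neg hva' h) (mul_neg_of_pos_of_neg (neg_pos.2 hva) h')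
          exact ⟨this.ne, by simp only [h.not_gt, this.not_gt]⟩
        · have h' : 0 < l k v' := (hs k hk).1 h
          have := add_pos (mul_pos hva' h) (mul_pos (neg_pos.2 hva) h')
          exact ⟨this.ne', by simp only [h, this]⟩
      refine ⟨l a v' • v + (-l a v) • v', ⟨U.add_mem (U.smul_mem _ hv) (U.smul_mem _ hv'), ?_⟩,
        fun k hk => (key k hk).1, filter_congr fun k hk => (key k hk).2⟩
      simp [mul_comm]
    · rintro ⟨v, ⟨hv, hva⟩, hne, rfl⟩
      replace hva : l a v = 0 := hva
      constructor
      · obtain ⟨ε, hε, hU, hne', heq⟩ := move v hv hne (-u) (U.neg_mem hu)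
        exact ⟨_, hU, hne', by simpa [hva] using mul_pos hε hua, heq.symm⟩
      · obtain ⟨ε, hε, hU, hne', heq⟩ := move v hv hne u hu
        exact ⟨_, hU, hne', by simpa [hva] using mul_pos hε hua, heq.symm⟩
  have hsplit : chambers l U (insert a A) = N ∪ insert a '' Q := by
    ext P
    constructor
    · rintro ⟨v, hv, hne, rfl⟩
      have hne' : ∀ k ∈ A, l k v ≠ 0 := fun k hk => hne k (mem_insert_of_mem hk)
      rcases (hne a (mem_insert_self a A)).lt_or_gt with h | h
      · exact Or.inl ⟨v, hv, hne', h, by rw [filter_insert, if_neg h.not_gt]⟩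
      · exact Or.inr ⟨_, ⟨v, hv, hne', h, rfl⟩, by rw [filter_insert, if_pos h]⟩
    · rintro (⟨v, hv, hne, hva, rfl⟩ | ⟨_, ⟨v, hv, hne, hva, rfl⟩, rfl⟩)
      · exact ⟨v, hv, by simpa using ⟨hva.ne, hne⟩, by rw [filter_insert, if_neg hva.not_gt]⟩
      · exact ⟨v, hv, by simpa using ⟨hva.ne', hne⟩, by rw [filter_insert, if_pos hva]⟩
  have hfin := finite_chambers l U A
  have hN : N.Finite := hfin.subset (hunion ▸ Set.subset_union_left)
  have hQ : Q.Finite := hfin.subset (hunion ▸ Set.subset_union_right)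
  have hdisj : Disjoint N (insert a '' Q) := by
    refine Set.disjoint_left.2 fun P hP => ?_
    rintro ⟨P', -, rfl⟩
    exact hNA _ hP (mem_insert_self a P')
  have hinj : Set.InjOn (insert a) Q := fun P hP P' hP' h => by
    rw [← erase_insert (hQA P hP), h, erase_insert (hQA P' hP')]
  rw [hsplit, Set.ncard_union_eq hdisj hN (hQ.image _), hinj.ncard_image, ← hunion, ← hinter,
    Set.ncard_union_add_ncard_inter N Q hN hQ]

/-- The sign with which the subfamily `S` is counted: `(-1)` to the size of `S` plus the
codimension of its intersection. -/
noncomputable def flatSign (U : Submodule ℝ V) (S : Finset ι) : ℤ :=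
  (-1) ^ (#S + finrank ℝ U + finrank ℝ (flat l U S))

theorem flatSign_empty (U : Submodule ℝ V) : flatSign l U ∅ = 1 := by
  rw [flatSign, flat_empty, card_empty, zero_add]
  exact Even.neg_one_pow ⟨_, rfl⟩

theorem flatSign_insert_of_le [DecidableEq ι] {U : Submodule ℝ V} {S : Finset ι} {a : ι}
    (ha : a ∉ S) (h : U ≤ LinearMap.ker (l a)) : flatSign l U (insert a S) = -flatSign l U S := by
  rw [flatSign, flat_insert, inf_eq_left.2 h, card_insert_of_notMem ha, flatSign]
  ring

theorem flatSign_insert_of_not_le [FiniteDimensional ℝ V] [DecidableEq ι] {U : Submodule ℝ V}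
    {S : Finset ι} {a : ι} (ha : a ∉ S) (h : ¬ U ≤ LinearMap.ker (l a)) :
    flatSign l U (insert a S) = flatSign l (U ⊓ LinearMap.ker (l a)) S := by
  rw [flatSign, flat_insert, card_insert_of_notMem ha, flatSign, ← finrank_inf_ker_add_one h]
  ring

/-- Zaslavsky's theorem, with the characteristic polynomial in Whitney's form. -/
theorem ncard_chambers [FiniteDimensional ℝ V] (U : Submodule ℝ V) (A : Finset ι) :
    ((chambers l U A).ncard : ℤ) = ∑ S ∈ A.powerset, flatSign l U S := by
  classical
  induction A using Finset.induction_on generalizing U with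
  | empty =>
    have : chambers l U ∅ = {∅} := by
      ext P
      simp only [chambers, Set.mem_ofPred_eq, Set.mem_singleton_iff]
      exact ⟨fun ⟨v, _, _, h⟩ => by simpa using h, fun h => ⟨0, U.zero_mem, by simp, by simp [h]⟩⟩
    simp [this, flatSign_empty]
  | insert a A ha ih =>
    rw [sum_powerset_insert ha]
    by_cases h : U ≤ LinearMap.ker (l a)
    · rw [chambers_insert_eq_empty l A h, Set.ncard_empty, ← sum_add_distrib, Nat.cast_zero]
      -- Subfamilies with and without `a` have the same flat and sizes of opposite parity, so they
      -- cancel in pairs.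
      refine (sum_eq_zero fun S hS => ?_).symm
      rw [flatSign_insert_of_le l (fun h' => ha (mem_powerset.1 hS h')) h, add_neg_cancel]
    · rw [ncard_chambers_insert l ha h, Nat.cast_add, ih, ih]
      congr 1
      refine sum_congr rfl fun S hS => ?_
      rw [flatSign_insert_of_not_le l (fun h' => ha (mem_powerset.1 hS h')) h]

open Classical in
/-- The signed count of the subfamilies of `A` whose intersection in `U` is that of `A`. -/
noncomputable def centerCount (U : Submodule ℝ V) (A : Finset ι) : ℤ :=
  ∑ S ∈ A.powerset with flat l U S = flat l U A, flatSign l U S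

theorem centerCount_insert_of_le [DecidableEq ι] {U : Submodule ℝ V} {A : Finset ι} {a : ι}
    (ha : a ∉ A) (h : U ≤ LinearMap.ker (l a)) : centerCount l U (insert a A) = 0 := by
  classical
  have hflat : ∀ S, flat l U (insert a S) = flat l U S := fun S => by
    rw [flat_insert, inf_eq_left.2 h]
  rw [centerCount, sum_filter, sum_powerset_insert ha, ← sum_add_distrib]
  refine sum_eq_zero fun S hS => ?_
  rw [hflat S, hflat A, flatSign_insert_of_le l (fun h' => ha (mem_powerset.1 hS h')) h]
  split_ifs <;> simp

open Classical in
-- Subfamilies containing `a` are counted in the restriction to its hyperplane. One avoiding `a` can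
-- have the full intersection only if `A` already cuts out a subspace of that hyperplane.
theorem centerCount_insert_of_not_le [FiniteDimensional ℝ V] {U : Submodule ℝ V}
    {A : Finset ι} {a : ι} (ha : a ∉ A) (h : ¬ U ≤ LinearMap.ker (l a)) :
    centerCount l U (insert a A) = centerCount l (U ⊓ LinearMap.ker (l a)) A +
      if flat l U A ≤ LinearMap.ker (l a) then centerCount l U A else 0 := by
  rw [centerCount, sum_filter, sum_powerset_insert ha, add_comm]
  congr 1
  · rw [centerCount, sum_filter]
    refine sum_congr rfl fun S hS => ?_
    rw [flat_insert, flat_insert,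
      flatSign_insert_of_not_le l (fun h' => ha (mem_powerset.1 hS h')) h]
  · split_ifs with hA
    · rw [centerCount, sum_filter, flat_insert', inf_eq_left.2 hA]
    · refine sum_eq_zero fun S hS => if_neg fun hS' => hA ?_
      refine (flat_anti l U (mem_powerset.1 hS)).trans (hS'.le.trans ?_)
      rw [flat_insert']
      exact inf_le_right

/-- This carries Rota's sign theorem. Both terms of the recursion are nonnegative. The restricted
term is positive unless some other hyperplane of `A` has the same trace on `U` as `a`; in that case
`a` is redundant and the other term is positive. -/
theorem centerCount_nonneg [FiniteDimensional ℝ V] (U : Submodule ℝ V) (A : Finset ι) :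
    0 ≤ centerCount l U A ∧ ((∀ k ∈ A, ¬ U ≤ LinearMap.ker (l k)) → 0 < centerCount l U A) := by
  classical
  induction A using Finset.induction_on generalizing U with
  | empty => simp [centerCount, flatSign_empty, filter_singleton]
  | insert a A ha ih =>
    by_cases h : U ≤ LinearMap.ker (l a)
    · rw [centerCount_insert_of_le l ha h]
      exact ⟨le_rfl, fun h' => absurd h (h' a (mem_insert_self a A))⟩
    rw [centerCount_insert_of_not_le l ha h]
    have hnn : 0 ≤ if flat l U A ≤ LinearMap.ker (l a) then centerCount l U A else 0 := by
      split_ifs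
      exacts [(ih U).1, le_rfl]
    refine ⟨add_nonneg (ih _).1 hnn, fun hA => ?_⟩
    by_cases hr : ∀ k ∈ A, ¬ U ⊓ LinearMap.ker (l a) ≤ LinearMap.ker (l k)
    · exact add_pos_of_pos_of_nonneg ((ih _).2 hr) hnn
    push Not at hr
    obtain ⟨k, hk, hle⟩ := hr
    have hk' : ¬ U ≤ LinearMap.ker (l k) := hA k (mem_insert_of_mem hk)
    have heq : U ⊓ LinearMap.ker (l a) = U ⊓ LinearMap.ker (l k) := by
      refine Submodule.eq_of_le_of_finrank_eq (le_inf inf_le_left hle) ?_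
      have h1 := finrank_inf_ker_add_one h
      have h2 := finrank_inf_ker_add_one hk'
      omega
    have hflat : flat l U A ≤ LinearMap.ker (l a) := by
      refine le_trans (fun v hv => ?_) (heq.ge.trans inf_le_right)
      exact ⟨((mem_flat l).1 hv).1, ((mem_flat l).1 hv).2 k hk⟩
    rw [if_pos hflat]
    exact add_pos_of_nonneg_of_pos (ih _).1 ((ih U).2 fun k hk => hA k (mem_insert_of_mem hk))

end Zaslavsky

end HypArr

/-! ### The Möbius function of the intersection lattice. -/

namespace HypArr

open Finset Module

open Classical in
/-- The Möbius function into a fixed element is determined by its sums over intervals. -/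
theorem eq_moebius_of_sum_eq {α : Type*} [PartialOrder α] [Fintype α] (b : α) (f : α → ℤ)
    (h : ∀ a ≤ b, ∑ x with a ≤ x ∧ x ≤ b, f x = if a = b then 1 else 0) (a : α) (hab : a ≤ b) :
    f a = moebius a b := by
  have hm : ∀ a, ∑ x with a ≤ x ∧ x ≤ b, moebius x b = if a = b then 1 else 0 := fun a => by
    let : LocallyFiniteOrder α := Fintype.toLocallyFiniteOrder
    rw [← IncidenceAlgebra.sum_Icc_mu_left]
    refine sum_congr ?_ fun _ _ => ?_
    · ext; simp
    · unfold moebius; congr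
  induction a using (wellFounded_gt : WellFounded ((· > ·) : α → α → Prop)).induction with
  | _ a ih =>
    have hmem : a ∈ univ.filter fun x => a ≤ x ∧ x ≤ b := by simp [hab]
    have h1 := (h a hab).trans (hm a).symm
    rw [← add_sum_erase _ _ hmem, ← add_sum_erase _ _ hmem] at h1
    have h2 : ∑ x ∈ (univ.filter fun x => a ≤ x ∧ x ≤ b).erase a, f x
        = ∑ x ∈ (univ.filter fun x => a ≤ x ∧ x ≤ b).erase a, moebius x b := by
      refine sum_congr rfl fun x hx => ?_
      simp only [mem_erase, mem_filter, mem_univ, true_and] at hx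
      exact ih x (lt_of_le_of_ne hx.2.1 hx.1.symm) hx.2.2
    rwa [h2, add_left_inj] at h1

section FlatMoebius

variable {V ι : Type*} [AddCommGroup V] [Module ℝ V] (l : ι → Dual ℝ V)

/-- The intersection lattice of a finite family of linear forms. -/
abbrev FlatLattice : Type _ := intersections fun k => LinearMap.ker (l k)

variable {l} in
theorem flat_mem_intersections (U : FlatLattice l) (S : Finset ι) :
    flat l U S ∈ intersections fun k => LinearMap.ker (l k) := by
  obtain ⟨_, s, rfl⟩ := U
  refine ⟨s ∪ S, ?_⟩
  ext v
  simp only [Submodule.mem_iInf, mem_flat, Set.mem_union, mem_coe, LinearMap.mem_ker]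
  exact ⟨fun h => ⟨fun k hk => h k (Or.inl hk), fun k hk => h k (Or.inr hk)⟩,
    fun h k hk => hk.elim (h.1 k) (h.2 k)⟩

variable {l} in
/-- A flat is cut out, within a larger subspace, by the hyperplanes that contain it. -/
theorem mem_flat_iff_forall {F : FlatLattice l} {v : V} :
    v ∈ (F : Submodule ℝ V) ↔ ∀ k, (F : Submodule ℝ V) ≤ LinearMap.ker (l k) → l k v = 0 := by
  refine ⟨fun hv k hk => hk hv, fun h => ?_⟩
  obtain ⟨_, s, rfl⟩ := F
  simp only [Submodule.mem_iInf]
  exact fun k hk => h k (iInf₂_le k hk)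

variable [Fintype ι]

open Classical in
/-- The hyperplanes that contain `T` but not `U`. -/
noncomputable def between (T U : Submodule ℝ V) : Finset ι :=
  {k | ¬ U ≤ LinearMap.ker (l k) ∧ T ≤ LinearMap.ker (l k)}

theorem mem_between {T U : Submodule ℝ V} {k : ι} :
    k ∈ between l T U ↔ ¬ U ≤ LinearMap.ker (l k) ∧ T ≤ LinearMap.ker (l k) := by
  simp [between]

theorem subset_between_iff {T U : Submodule ℝ V} (hTU : T ≤ U) {S : Finset ι} :
    S ⊆ between l T U ↔ S ⊆ between l ⊥ U ∧ T ≤ flat l U S := by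
  constructor
  · refine fun h => ⟨fun k hk => ?_, fun v hv => (mem_flat l).2 ⟨hTU hv, fun k hk => ?_⟩⟩
    · exact (mem_between l).2 ⟨((mem_between l).1 (h hk)).1, bot_le⟩
    · exact ((mem_between l).1 (h hk)).2 hv
  · exact fun h k hk => (mem_between l).2 ⟨((mem_between l).1 (h.1 hk)).1,
      fun v hv => ((mem_flat l).1 (h.2 hv)).2 k hk⟩

variable {l} in
theorem flat_between {F U : FlatLattice l} (h : F ≤ U) : flat l U (between l F U) = F := by
  refine le_antisymm (fun v hv => ?_) (((subset_between_iff l h).1 subset_rfl).2)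
  rw [mem_flat] at hv
  refine mem_flat_iff_forall.2 fun k hk => ?_
  by_cases hU : (U : Submodule ℝ V) ≤ LinearMap.ker (l k)
  · exact hU hv.1
  · exact hv.2 k ((mem_between l).2 ⟨hU, hk⟩)

variable {l} in
open Classical in
/-- Summing over subfamilies of hyperplanes according to their intersection. -/
theorem sum_powerset_between (U : FlatLattice l) {T : Submodule ℝ V} (hT : T ≤ U)
    (f : Finset ι → ℤ) :
    ∑ S ∈ (between l T U).powerset, f S = ∑ F : FlatLattice l with F ≤ U ∧ T ≤ F,
      ∑ S ∈ (between l ⊥ U).powerset with flat l U S = F, f S := by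
  rw [← sum_fiberwise_of_maps_to (s := (between l T U).powerset)
    (g := fun S => (⟨flat l U S, flat_mem_intersections U S⟩ : FlatLattice l))]
  · refine sum_congr rfl fun F hF => sum_congr ?_ fun _ _ => rfl
    ext S
    simp only [mem_filter, mem_univ, true_and] at hF
    simp only [mem_filter, mem_powerset, Subtype.ext_iff, subset_between_iff l hT]
    exact ⟨fun h => ⟨h.1.1, h.2⟩, fun h => ⟨⟨h.1, h.2.symm ▸ hF.2⟩, h.2⟩⟩
  · intro S hS
    rw [mem_powerset, subset_between_iff l hT] at hS
    simp only [mem_filter, mem_univ, true_and]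
    exact ⟨Subtype.coe_le_coe.1 inf_le_left, hS.2⟩

variable {l} in
open Classical in
/-- Whitney's formula for the Möbius function of the intersection lattice. -/
theorem moebius_eq_sum_neg_one_pow {F U : FlatLattice l} (h : F ≤ U) :
    moebius F U = ∑ S ∈ (between l ⊥ U).powerset with flat l U S = F, (-1 : ℤ) ^ #S := by
  refine (eq_moebius_of_sum_eq U (fun F : FlatLattice l =>
    ∑ S ∈ (between l ⊥ U).powerset with flat l U S = F, (-1 : ℤ) ^ #S) (fun a ha => ?_) F h).symm
  -- The alternating sum over all subfamilies is 0 unless there are no hyperplanes between `a` and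
  -- `U`, that is, unless `a = U`: this is the Möbius recursion.
  have h1 := sum_powerset_between U ha (fun S => (-1 : ℤ) ^ #S)
  rw [sum_powerset_neg_one_pow_card] at h1
  have h2 : between l a U = ∅ ↔ a = U := by
    constructor
    · intro h
      have := flat_between ha
      rw [h, flat_empty] at this
      exact Subtype.ext this.symm
    · rintro rfl
      exact eq_empty_of_forall_notMem fun k hk => ((mem_between l).1 hk).1 ((mem_between l).1 hk).2
  simp only [h2] at h1
  refine (Eq.trans ?_ h1.symm).trans (by congr)
  refine sum_congr ?_ fun _ _ => rfl
  ext x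
  simp only [mem_filter, mem_univ, true_and, Subtype.coe_le_coe]
  exact and_comm

variable {l} in
open Classical in
/-- Rota's sign theorem: the Möbius function of the intersection lattice does not vanish on
intervals, and its sign is given by the codimension. -/
theorem sum_flatSign_eq_natAbs_moebius [FiniteDimensional ℝ V] {F U : FlatLattice l} (h : F ≤ U) :
    0 < (moebius F U).natAbs ∧
    ∑ S ∈ (between l ⊥ U).powerset with flat l U S = F, flatSign l U S
      = (moebius F U).natAbs := by
  have h1 : ∑ S ∈ (between l ⊥ U).powerset with flat l U S = F, flatSign l U S
      = centerCount l U (between l F U) := by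
    rw [centerCount, flat_between h]
    refine sum_congr ?_ fun _ _ => rfl
    ext S
    simp only [mem_filter, mem_powerset, subset_between_iff l (Subtype.coe_le_coe.2 h)]
    exact ⟨fun h => ⟨⟨h.1, h.2.ge⟩, h.2⟩, fun h => ⟨h.1.1, h.2⟩⟩
  -- With the flat fixed, the dimension part of the sign is constant, so the sum is `μ` up to sign;
  -- positivity then makes it `|μ|`.
  have h2 : ∑ S ∈ (between l ⊥ U).powerset with flat l U S = F, flatSign l U S
      = (-1) ^ (finrank ℝ U + finrank ℝ F) * moebius F U := by
    rw [moebius_eq_sum_neg_one_pow h, mul_sum]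
    refine sum_congr rfl fun S hS => ?_
    rw [flatSign, (mem_filter.1 hS).2]
    ring
  have h3 := (centerCount_nonneg l U (between l F U)).2 fun k hk => ((mem_between l).1 hk).1
  have h4 : ∑ S ∈ (between l ⊥ U).powerset with flat l U S = F, flatSign l U S
      = (moebius F U).natAbs := by
    have hpos := h3
    rw [← h1, h2] at hpos
    rw [h2, Int.natCast_natAbs, ← abs_of_pos hpos, abs_mul, abs_pow, abs_neg, abs_one, one_pow,
      one_mul]
  refine ⟨?_, h4⟩
  rw [← h1, h4] at h3
  exact_mod_cast h3

variable {l} in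
open Classical in
/-- The number of chambers of the hyperplanes between `T` and `U`, in terms of the Möbius function
of the intersection lattice. -/
theorem ncard_chambers_between [FiniteDimensional ℝ V] (U : FlatLattice l) {T : Submodule ℝ V}
    (hT : T ≤ U) : (chambers l U (between l T U)).ncard
      = ∑ F : FlatLattice l with F ≤ U ∧ T ≤ F, (moebius F U).natAbs := by
  have h := ncard_chambers l U (between l T U)
  rw [sum_powerset_between U hT, sum_congr rfl fun F hF =>
    (sum_flatSign_eq_natAbs_moebius (mem_filter.1 hF).2.1).2] at h
  exact_mod_cast h

end FlatMoebius

end HypArr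

namespace HypArr

open Finset Module

/-! ### Multiplication rules for the five signs. -/

namespace CSign

theorem mul_mul_self : ∀ a b : CSign, a * b * a = a * b := by decide

theorem mul_eq_one_iff : ∀ a b : CSign, a * b = 1 ↔ a = 1 ∧ b = 1 := by decide

theorem height_mul_le_iff : ∀ a b : CSign,
    (a * b).height ≤ 1 ↔ a.height ≤ 1 ∧ b.height ≤ 1 := by decide

theorem mul_eq_right : ∀ a b : CSign, a.height ≤ 1 → ¬ b.height ≤ 1 → a * b = b := by decide

theorem eq_of_mul_eq_right_of_height : ∀ a b : CSign, ¬ a.height ≤ 1 → a * b = b → b = a := by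
  decide

theorem eq_of_mul_eq_right_of_ne_one : ∀ a b : CSign, a ≠ 1 → a.height ≤ 1 → b.height ≤ 1 →
    a * b = b → b = a := by decide

theorem eq_of_eq_i_iff : ∀ a b : CSign, ¬ a.height ≤ 1 → ¬ b.height ≤ 1 → (a = i ↔ b = i) →
    a = b := by decide

theorem eq_of_eq_pos_iff : ∀ a b : CSign, a ≠ 1 → b ≠ 1 → a.height ≤ 1 → b.height ≤ 1 →
    (a = pos ↔ b = pos) → a = b := by decide

theorem mul_eq_self_of_maximal : ∀ a b : CSign, a * b = a → a.height ≤ 1 → b.height ≤ 1 := by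
  decide

theorem ofComplex_eq_i_iff (z : ℂ) : ofComplex z = i ↔ 0 < z.im := by
  unfold ofComplex
  split_ifs <;> simp_all

theorem ofComplex_eq_pos_iff (z : ℂ) : ofComplex z = pos ↔ z.im = 0 ∧ 0 < z.re := by
  unfold ofComplex
  split_ifs <;> simp_all

end CSign

/-! ### Supports and the characters they define. -/

section Support

variable {d t : ℕ} {l : Fin t → Dual ℂ (Fin d → ℂ)}

/-- Membership in each augmented subspace can be read off the position vector, so a single point of
the cone decides. -/
theorem spanMap_le_iff_mem {Z : faces l} {z : Fin d → ℂ} (hz : position l z = Z) (X : AugLattice l) :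
    spanMap l Z ≤ X ↔ z ∈ (X : Submodule ℝ (Fin d → ℂ)) := by
  rw [spanMap_le_iff]
  refine ⟨fun h => h z hz, fun h z' hz' => ?_⟩
  obtain ⟨_, s, rfl⟩ := X
  simp only [Submodule.mem_iInf] at h ⊢
  rintro (k | k) hk
  · rw [mem_augmented_inl, hz', ← hz, ← mem_augmented_inl]
    exact h _ hk
  · rw [mem_augmented_inr, hz', ← hz, ← mem_augmented_inr]
    exact h _ hk

/-- A composition of signs is zero, or real, exactly when both factors are. This makes the indicator
of small support multiplicative. -/
theorem spanMap_mul_le_iff (Z W : faces l) (X : AugLattice l) :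
    spanMap l (Z * W) ≤ X ↔ spanMap l Z ≤ X ∧ spanMap l W ≤ X := by
  refine ⟨fun h => ?_, fun h => (fiber l X).mul_mem h.1 h.2⟩
  obtain ⟨_, z, rfl⟩ := Z
  obtain ⟨_, w, rfl⟩ := W
  obtain ⟨v, hv⟩ := (faces l).mul_mem ⟨z, rfl⟩ ⟨w, rfl⟩
  rw [spanMap_le_iff_mem (z := v) hv] at h
  rw [spanMap_le_iff_mem (z := z) rfl, spanMap_le_iff_mem (z := w) rfl]
  obtain ⟨_, s, rfl⟩ := X
  simp only [Submodule.mem_iInf] at h ⊢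
  have key : ∀ k ∈ s, z ∈ augmented l k ∧ w ∈ augmented l k := by
    rintro (k | k) hk
    · have := h _ hk
      rw [mem_augmented_inl, hv, Pi.mul_apply, CSign.mul_eq_one_iff] at this
      simpa only [mem_augmented_inl] using this
    · have := h _ hk
      rw [mem_augmented_inr, hv, Pi.mul_apply, CSign.height_mul_le_iff] at this
      simpa only [mem_augmented_inr] using this
  exact ⟨fun k hk => (key k hk).1, fun k hk => (key k hk).2⟩

theorem isLeftRegularBand_fiber (X : AugLattice l) : IsLeftRegularBand (fiber l X) := fun _ _ =>
  Subtype.ext (Subtype.ext (funext fun _ => CSign.mul_mul_self _ _))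

open Classical in
/-- The indicator of the elements of support at most `Y`, as a character of the fiber semigroup. -/
noncomputable def supportCharacter {X : AugLattice l} (Y : AugLattice l) : fiber l X →* ℝ where
  toFun y := if spanMap l y.1 ≤ Y then 1 else 0
  map_one' := if_pos (show spanMap l (1 : fiber l X).1 ≤ Y from (fiber l Y).one_mem)
  map_mul' x y := by
    simp only [Submonoid.coe_mul, spanMap_mul_le_iff, ite_and, mul_ite, mul_one, mul_zero]
    split_ifs <;> rfl

open Classical in
theorem supportCharacter_apply {X : AugLattice l} (Y : AugLattice l) (x : fiber l X) :
    supportCharacter Y x = if spanMap l x.1 ≤ Y then 1 else 0 := rfl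

end Support

/-! ### Maximal elements and fixed points in the fiber semigroup at `[π, ⊤]`. -/

section FiberSemigroup

variable {d t : ℕ} {l : Fin t → Dual ℝ (Fin d → ℝ)} {π : IntersectionLattice l}

variable (l π) in
/-- The fiber semigroup at `[π, ⊤]`. -/
abbrev FiberSemigroup : Type :=
  fiber (complexify l) (intervalIso l (upperInterval l π))

namespace FiberSemigroup

/-- The sign vector of an element of the fiber semigroup. -/
def sign (c : FiberSemigroup l π) (k : Fin t) : CSign := c.1.1 k

theorem sign_mul (c e : FiberSemigroup l π) (k : Fin t) : (c * e).sign k = c.sign k * e.sign k :=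
  rfl

theorem ext_sign {c e : FiberSemigroup l π} (h : ∀ k, c.sign k = e.sign k) : c = e :=
  Subtype.ext (Subtype.ext (funext h))

/-- The element of the fiber semigroup given by the point `x + iy`. -/
noncomputable def ofPoint (x y : Fin d → ℝ) (hy : y ∈ (π : Submodule ℝ (Fin d → ℝ))) :
    FiberSemigroup l π :=
  ⟨⟨position (complexify l) fun m => ⟨x m, y m⟩, _, rfl⟩,
    (spanMap_le_iff_mem rfl _).2 ⟨hy, Submodule.mem_top⟩⟩

theorem exists_eq_ofPoint (c : FiberSemigroup l π) : ∃ x y hy, c = ofPoint x y hy := by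
  obtain ⟨⟨_, z, rfl⟩, hz⟩ := c
  replace hz : spanMap (complexify l) _ ≤ _ := hz
  rw [spanMap_le_iff_mem (z := z) rfl] at hz
  exact ⟨fun m => (z m).re, fun m => (z m).im, hz.1, rfl⟩

section OfPoint

variable (x y : Fin d → ℝ) (hy : y ∈ (π : Submodule ℝ (Fin d → ℝ))) (k : Fin t)

theorem sign_ofPoint :
    (ofPoint x y hy : FiberSemigroup l π).sign k = CSign.ofComplex ⟨l k x, l k y⟩ := by
  change CSign.ofComplex (complexify l k _) = _
  rw [complexify_apply]
  congr 1
  apply Complex.ext <;> simp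

theorem sign_ofPoint_eq_one_iff :
    (ofPoint x y hy : FiberSemigroup l π).sign k = 1 ↔ l k x = 0 ∧ l k y = 0 := by
  rw [sign_ofPoint, CSign.ofComplex_eq_one_iff, Complex.ext_iff]
  rfl

theorem height_sign_ofPoint_le_iff :
    ((ofPoint x y hy : FiberSemigroup l π).sign k).height ≤ 1 ↔ l k y = 0 := by
  rw [sign_ofPoint, CSign.height_ofComplex_le_iff]

theorem sign_ofPoint_eq_i_iff :
    (ofPoint x y hy : FiberSemigroup l π).sign k = CSign.i ↔ 0 < l k y := by
  rw [sign_ofPoint, CSign.ofComplex_eq_i_iff]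

theorem sign_ofPoint_eq_pos_iff :
    (ofPoint x y hy : FiberSemigroup l π).sign k = CSign.pos ↔ l k y = 0 ∧ 0 < l k x := by
  rw [sign_ofPoint, CSign.ofComplex_eq_pos_iff]

theorem spanMap_ofPoint_le_iff (J : Intervals (IntersectionLattice l)) :
    spanMap (complexify l) (ofPoint x y hy : FiberSemigroup l π).1 ≤ intervalIso l J ↔
      y ∈ (J.1.1 : Submodule ℝ (Fin d → ℝ)) ∧ x ∈ (J.1.2 : Submodule ℝ (Fin d → ℝ)) :=
  spanMap_le_iff_mem (Z := (ofPoint x y hy : FiberSemigroup l π).1) (z := fun m => ⟨x m, y m⟩) rfl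
    (intervalIso l J)

end OfPoint

theorem height_sign_le (c : FiberSemigroup l π) {k : Fin t}
    (hk : (π : Submodule ℝ (Fin d → ℝ)) ≤ LinearMap.ker (l k)) : (c.sign k).height ≤ 1 := by
  obtain ⟨x, y, hy, rfl⟩ := exists_eq_ofPoint c
  exact (height_sign_ofPoint_le_iff x y hy k).2 (hk hy)

/-- Imaginary parts range over `π`, so the best possible sign is real and nonzero on hyperplanes
containing `π`, and `i` or `j` on the others. Any smaller sign is raised by composing with a purely
real or purely imaginary point. -/
theorem mem_maxElements_iff (hl : ∀ k, l k ≠ 0) (c : FiberSemigroup l π) :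
    c ∈ maxElements (FiberSemigroup l π) ↔
      (∀ k, (π : Submodule ℝ (Fin d → ℝ)) ≤ LinearMap.ker (l k) → c.sign k ≠ 1) ∧
      ∀ k, ¬ (π : Submodule ℝ (Fin d → ℝ)) ≤ LinearMap.ker (l k) → ¬ (c.sign k).height ≤ 1 := by
  constructor
  · intro hc
    have hmul : ∀ (e : FiberSemigroup l π) k, c.sign k * e.sign k = c.sign k := fun e k => by
      rw [← sign_mul, mul_eq_of_mem_maxElements (isLeftRegularBand_fiber _) hc]
    refine ⟨fun k _ h1 => ?_, fun k hk h1 => ?_⟩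
    · obtain ⟨v, hv⟩ : ∃ v, l k v ≠ 0 := by
        by_contra! h
        exact hl k (LinearMap.ext h)
      have := hmul (ofPoint v 0 (Submodule.zero_mem _)) k
      rw [h1, one_mul, sign_ofPoint_eq_one_iff] at this
      exact hv this.1
    · obtain ⟨v, hvπ, hv⟩ := SetLike.not_le_iff_exists.1 hk
      have := CSign.mul_eq_self_of_maximal _ _ (hmul (ofPoint 0 v hvπ) k) h1
      rw [height_sign_ofPoint_le_iff] at this
      exact hv this
  · rintro ⟨h1, h2⟩ e he
    refine ext_sign fun k => ?_
    have hk : c.sign k * e.sign k = e.sign k := by rw [← sign_mul, he]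
    by_cases hπ : (π : Submodule ℝ (Fin d → ℝ)) ≤ LinearMap.ker (l k)
    · exact CSign.eq_of_mul_eq_right_of_ne_one _ _ (h1 k hπ) (height_sign_le c hπ)
        (height_sign_le e hπ) hk
    · exact CSign.eq_of_mul_eq_right_of_height _ _ (h2 k hπ) hk

/-- The maximal elements fixed by the element with point `x + iy` correspond to pairs of
a chamber of the restriction to `π` around `y` and a chamber of the localization at `π`
around `x`. -/
theorem card_fixed_maxElements (hl : ∀ k, l k ≠ 0) (x y : Fin d → ℝ)
    (hy : y ∈ (π : Submodule ℝ (Fin d → ℝ))) :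
    Nat.card {c : maxElements (FiberSemigroup l π) // ofPoint x y hy * (c : FiberSemigroup l π) = c}
      = (chambers l π (between l (Submodule.span ℝ {y}) π)).ncard *
        (chambers l ⊤ (between l ((π : Submodule ℝ (Fin d → ℝ)) ⊔ Submodule.span ℝ {x}) ⊤)).ncard := by
  classical
  set p : FiberSemigroup l π := ofPoint x y hy with hp
  set A := between l (Submodule.span ℝ {y}) π with hA
  set B := between l ((π : Submodule ℝ (Fin d → ℝ)) ⊔ Submodule.span ℝ {x}) ⊤ with hB
  -- `A` and `B` index exactly the signs that `p` leaves undecided; all others are forced on a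
  -- maximal element fixed by `p`.
  have memA : ∀ k, k ∈ A ↔ ¬ (π : Submodule ℝ (Fin d → ℝ)) ≤ LinearMap.ker (l k) ∧
      (p.sign k).height ≤ 1 := fun k => by
    rw [hA, mem_between, Submodule.span_singleton_le_iff_mem, hp, height_sign_ofPoint_le_iff,
      LinearMap.mem_ker]
  have memB : ∀ k, k ∈ B ↔ (π : Submodule ℝ (Fin d → ℝ)) ≤ LinearMap.ker (l k) ∧
      p.sign k = 1 := fun k => by
    rw [hB, mem_between, sup_le_iff, Submodule.span_singleton_le_iff_mem, hp,
      sign_ofPoint_eq_one_iff, LinearMap.mem_ker, top_le_iff, LinearMap.ker_eq_top]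
    exact ⟨fun h => ⟨h.2.1, h.2.2, h.2.1 hy⟩, fun h => ⟨hl k, h.1, h.2.1⟩⟩
  rw [← Set.ncard_prod, ← Nat.card_coe_set_eq]
  let f : FiberSemigroup l π → Finset (Fin t) × Finset (Fin t) :=
    fun c => (A.filter (c.sign · = CSign.i), B.filter (c.sign · = CSign.pos))
  have hf : ∀ x y hy, (∀ k ∈ A, l k y ≠ 0) → (∀ k ∈ B, l k x ≠ 0) →
      f (ofPoint x y hy) = ({k ∈ A | 0 < l k y}, {k ∈ B | 0 < l k x}) := fun x y hy _ _ => by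
    refine Prod.ext (filter_congr fun k _ => sign_ofPoint_eq_i_iff x y hy k)
      (filter_congr fun k hk => ?_)
    rw [sign_ofPoint_eq_pos_iff]
    exact and_iff_right (((memB k).1 hk).1 hy)
  refine Nat.card_congr (Equiv.ofBijective (fun c => ⟨f c.1.1, ?_⟩) ⟨?_, ?_⟩)
  · obtain ⟨⟨c, hc⟩, hpc⟩ := c
    obtain ⟨x', y', hy', rfl⟩ := exists_eq_ofPoint c
    rw [mem_maxElements_iff hl] at hc
    have h1 : ∀ k ∈ A, l k y' ≠ 0 := fun k hk => by
      have := hc.2 k ((memA k).1 hk).1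
      rwa [height_sign_ofPoint_le_iff] at this
    have h2 : ∀ k ∈ B, l k x' ≠ 0 := fun k hk h => by
      refine hc.1 k ((memB k).1 hk).1 ((sign_ofPoint_eq_one_iff x' y' hy' k).2 ⟨h, ?_⟩)
      exact ((memB k).1 hk).1 hy'
    rw [hf x' y' hy' h1 h2]
    exact ⟨⟨y', hy', h1, by congr⟩, ⟨x', Submodule.mem_top, h2, by congr⟩⟩
  · rintro ⟨⟨c, hc⟩, hpc⟩ ⟨⟨e, he⟩, hpe⟩ h
    replace h : f c = f e := congrArg Subtype.val h
    rw [mem_maxElements_iff hl] at hc he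
    refine Subtype.ext (Subtype.ext (ext_sign fun k => ?_))
    change c.sign k = e.sign k
    have hpc' : p.sign k * c.sign k = c.sign k := by rw [← sign_mul, hpc]
    have hpe' : p.sign k * e.sign k = e.sign k := by rw [← sign_mul, hpe]
    by_cases hπ : (π : Submodule ℝ (Fin d → ℝ)) ≤ LinearMap.ker (l k)
    · by_cases hk : p.sign k = 1
      · refine CSign.eq_of_eq_pos_iff _ _ (hc.1 k hπ) (he.1 k hπ) (height_sign_le c hπ)
          (height_sign_le e hπ) ?_
        have := Finset.ext_iff.1 (congrArg Prod.snd h) k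
        simpa [f, (memB k).2 ⟨hπ, hk⟩] using this
      · rw [CSign.eq_of_mul_eq_right_of_ne_one _ _ hk (height_sign_le p hπ) (height_sign_le c hπ) hpc',
          CSign.eq_of_mul_eq_right_of_ne_one _ _ hk (height_sign_le p hπ) (height_sign_le e hπ) hpe']
    · by_cases hk : (p.sign k).height ≤ 1
      · refine CSign.eq_of_eq_i_iff _ _ (hc.2 k hπ) (he.2 k hπ) ?_
        have := Finset.ext_iff.1 (congrArg Prod.fst h) k
        simpa [f, (memA k).2 ⟨hπ, hk⟩] using this
      · rw [CSign.eq_of_mul_eq_right_of_height _ _ hk hpc',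
          CSign.eq_of_mul_eq_right_of_height _ _ hk hpe']
  · rintro ⟨⟨P, Q⟩, ⟨y', hy', h1, hP⟩, ⟨x', hx', h2, hQ⟩⟩
    change P = _ at hP
    change Q = _ at hQ
    subst hP hQ
    -- For surjectivity, representatives of the two chambers are combined into one point and
    -- multiplied by `p`: this fills in the forced signs and keeps those on `A` and `B`.
    have hpp : p * (p * ofPoint x' y' hy') = p * ofPoint x' y' hy' := by
      rw [← mul_assoc, (isLeftRegularBand_fiber _).mul_self]
    have hmax : p * ofPoint x' y' hy' ∈ maxElements (FiberSemigroup l π) := by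
      rw [mem_maxElements_iff hl]
      refine ⟨fun k hk h => ?_, fun k hk h => ?_⟩
      · rw [sign_mul, CSign.mul_eq_one_iff] at h
        exact h2 k ((memB k).2 ⟨hk, h.1⟩) ((sign_ofPoint_eq_one_iff x' y' hy' k).1 h.2).1
      · rw [sign_mul, CSign.height_mul_le_iff] at h
        exact h1 k ((memA k).2 ⟨hk, h.1⟩) ((height_sign_ofPoint_le_iff x' y' hy' k).1 h.2)
    refine ⟨⟨⟨_, hmax⟩, hpp⟩, Subtype.ext ?_⟩
    have : f (p * ofPoint x' y' hy') = f (ofPoint x' y' hy') := by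
      refine Prod.ext (filter_congr fun k hk => ?_) (filter_congr fun k hk => ?_)
      · rw [sign_mul, CSign.mul_eq_right _ _ ((memA k).1 hk).2]
        rw [height_sign_ofPoint_le_iff]
        exact h1 k hk
      · rw [sign_mul, ((memB k).1 hk).2, one_mul]
    change f (p * ofPoint x' y' hy') = _
    rw [this, hf x' y' hy' h1 h2]

open Classical in
theorem card_fixed_maxElements_eq_sum (hl : ∀ k, l k ≠ 0) (c : FiberSemigroup l π) :
    (Nat.card {e : maxElements (FiberSemigroup l π) // c * (e : FiberSemigroup l π) = e} : ℝ)
      = ∑ J : Intervals (IntersectionLattice l) with J.1.1 ≤ π ∧ π ≤ J.1.2,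
        (intervalMultiplicity π J : ℝ) * supportCharacter (intervalIso l J) c := by
  obtain ⟨x, y, hy, rfl⟩ := exists_eq_ofPoint c
  have h1 := ncard_chambers_between (l := l) π (T := Submodule.span ℝ {y})
    ((Submodule.span_singleton_le_iff_mem _ _).2 hy)
  have h2 := ncard_chambers_between (l := l) ⊤
    (T := (π : Submodule ℝ (Fin d → ℝ)) ⊔ Submodule.span ℝ {x}) le_top
  rw [card_fixed_maxElements hl, h1]
  -- The top flat is the whole space only after unfolding.
  erw [h2]
  rw [sum_mul_sum, ← sum_product']
  simp only [supportCharacter_apply, spanMap_ofPoint_le_iff, mul_ite,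
    mul_one, mul_zero]
  rw [← sum_filter, filter_filter, Nat.cast_sum]
  symm
  refine sum_bij (fun J _ => J.1) ?_ ?_ ?_ ?_
  · intro J hJ
    simp only [mem_filter, mem_univ, true_and, mem_product, Submodule.span_singleton_le_iff_mem,
      sup_le_iff] at hJ ⊢
    exact ⟨⟨hJ.1.1, hJ.2.1⟩, le_top, hJ.1.2, hJ.2.2⟩
  · exact fun J _ J' _ h => Subtype.ext h
  · intro q hq
    simp only [mem_filter, mem_univ, true_and, mem_product, Submodule.span_singleton_le_iff_mem,
      sup_le_iff] at hq
    refine ⟨⟨q, hq.1.1.trans hq.2.2.1⟩, ?_, rfl⟩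
    simp only [mem_filter, mem_univ, true_and]
    exact ⟨⟨hq.1.1, hq.2.2.1⟩, hq.1.2, hq.2.2.2⟩
  · intro J _
    rw [intervalMultiplicity, Int.natAbs_mul]

end FiberSemigroup

/-- Nonvanishing of the Möbius function ensures that no factor drops out of the characteristic
polynomial. -/
theorem intervalMultiplicity_pos {J : Intervals (IntersectionLattice l)} (h : J.1.1 ≤ π) :
    0 < intervalMultiplicity π J := by
  rw [intervalMultiplicity, Int.natAbs_mul]
  exact Nat.mul_pos (sum_flatSign_eq_natAbs_moebius h).1 (sum_flatSign_eq_natAbs_moebius le_top).1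

theorem eigenvalue_eq_sum_supportCharacter (w : FiberSemigroup l π → ℝ)
    (J : Intervals (IntersectionLattice l)) :
    eigenvalue w J = ∑ x, w x * supportCharacter (intervalIso l J) x := by
  classical
  simp [eigenvalue, supportCharacter_apply, sum_filter]

end FiberSemigroup

end HypArr

namespace HypArr

open Finset Module

/-! ### The spectrum of the walk on the fiber semigroup. -/

section FiberSemigroup

variable {d t : ℕ} {l : Fin t → Dual ℝ (Fin d → ℝ)} {π : IntersectionLattice l}

open Classical in
theorem charpoly_transitionMatrix_fiberSemigroup [D : DecidableEq (maxElements (FiberSemigroup l π))]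
    (hl : ∀ k, l k ≠ 0) (w : FiberSemigroup l π → ℝ) (hw : ∀ x, 0 ≤ w x) :
    @Matrix.charpoly ℝ _ _ D _ (transitionMatrix w) =
      ∏ J : Intervals (IntersectionLattice l) with J.1.1 ≤ π ∧ π ≤ J.1.2,
        (Polynomial.X - Polynomial.C (eigenvalue w J)) ^ intervalMultiplicity π J := by
  simp only [eigenvalue_eq_sum_supportCharacter]
  exact charpoly_transitionMatrix (isLeftRegularBand_fiber _) w hw _ _ _
    (FiberSemigroup.card_fixed_maxElements_eq_sum hl)

theorem hasEigenvalue_transitionMatrix_iff [D : DecidableEq (maxElements (FiberSemigroup l π))]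
    (hl : ∀ k, l k ≠ 0) (w : FiberSemigroup l π → ℝ) (hw : ∀ x, 0 ≤ w x) (r : ℝ) :
    Module.End.HasEigenvalue (Matrix.toLin' (transitionMatrix w)) r ↔
      ∃ J : Intervals (IntersectionLattice l), J.1.1 ≤ π ∧ π ≤ J.1.2 ∧ r = eigenvalue w J := by
  rw [Module.End.hasEigenvalue_iff_isRoot_charpoly, Matrix.charpoly_toLin',
    charpoly_transitionMatrix_fiberSemigroup hl w hw, Polynomial.IsRoot, Polynomial.eval_prod,
    prod_eq_zero_iff]
  refine exists_congr fun J => ?_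
  simp only [mem_filter, mem_univ, true_and, Polynomial.eval_pow, Polynomial.eval_sub,
    Polynomial.eval_X, Polynomial.eval_C, and_assoc]
  refine and_congr_right fun h => and_congr_right fun _ => ?_
  rw [pow_eq_zero_iff (intervalMultiplicity_pos h).ne', sub_eq_zero]

end FiberSemigroup

end HypArr

theorem theorem4p11 {d t : ℕ} (l : Fin t → Module.Dual ℝ (Fin d → ℝ)) (hl : ∀ k, l k ≠ 0)
    (π : IntersectionLattice l)
    (w : fiber (complexify l) (intervalIso l (upperInterval l π)) → ℝ)
    (hw : w ∈ stdSimplex ℝ (fiber (complexify l) (intervalIso l (upperInterval l π)))) :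
    -- the transition matrix is diagonalizable
    IsDiagonalizable (transitionMatrix w) ∧
    -- each interval `[α, β]` containing `π` gives an eigenvalue
    (∀ J : Intervals (IntersectionLattice l), J.1.1 ≤ π → π ≤ J.1.2 →
      Module.End.HasEigenvalue (Matrix.toLin' (transitionMatrix w)) (eigenvalue w J)) ∧
    -- the eigenvalue of `[α, β]` has multiplicity `|μ(α, π) μ(β, ⊤)|`
    (open Classical in (transitionMatrix w).charpoly =
      ∏ J : Intervals (IntersectionLattice l) with J.1.1 ≤ π ∧ π ≤ J.1.2,
        (Polynomial.X - Polynomial.C (eigenvalue w J)) ^ intervalMultiplicity π J) ∧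
    -- these are all the eigenvalues
    (∀ r : ℝ, Module.End.HasEigenvalue (Matrix.toLin' (transitionMatrix w)) r →
      ∃ J : Intervals (IntersectionLattice l), J.1.1 ≤ π ∧ π ≤ J.1.2 ∧ r = eigenvalue w J) ∧
    -- the stationary distribution is unique when the support of `w` generates the semigroup
    (Submonoid.closure {x | 0 < w x} = ⊤ →
      ∃! p : maxElements (fiber (complexify l) (intervalIso l (upperInterval l π))) → ℝ,
        p ∈ stdSimplex ℝ (maxElements (fiber (complexify l) (intervalIso l (upperInterval l π)))) ∧
          Matrix.vecMul p (transitionMatrix w) = p) :=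
  ⟨isDiagonalizable_transitionMatrix (isLeftRegularBand_fiber _) w hw.1,
    fun J h1 h2 => (hasEigenvalue_transitionMatrix_iff hl w hw.1 _).2 ⟨J, h1, h2, rfl⟩,
    charpoly_transitionMatrix_fiberSemigroup hl w hw.1,
    fun r => (hasEigenvalue_transitionMatrix_iff hl w hw.1 r).1,
    existsUnique_stationary_transitionMatrix (isLeftRegularBand_fiber _) hw⟩
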